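/- An almost hypercomplex manifold with Hermitian and Norden metrics of dimension $4n$ is a smooth $4n$-dimensional manifold $M$ with smooth fields of endomorphisms $J_1,J_2,J_3$ of the tangent spaces such that $J_\alpha^2=-I$ and $J_\alpha=J_\beta J_\gamma=-J_\gamma J_\beta$ for all cyclic permutations $(\alpha,\beta,\gamma)$ of $(1,2,3)$, and with a pseudo-Riemannian metric $g$ such that $g(J_1X,J_1Y)=-g(J_2X,J_2Y)=-g(J_3X,J_3Y)=g(X,Y)$. Let $\nabla$ be the Levi-Civita connection of $g$, let $F_\alpha(X,Y,Z)=g((\nabla_XJ_\alpha)Y,Z)$, and let $\theta_\alpha(Z)=\sum_{i,j}g^{ij}F_\alpha(e_i,e_j,Z)$ be the Lee forms, where $(e_i)$ is a basis of the tangent space and $(g^{ij})$ is the inverse of the matrix $(g(e_i,e_j))$. Such a manifold is a $\mathcal W$-manifold if the Nijenhuis tensors of $J_1,J_2,J_3$ vanish and $$F_1(X,Y,Z)=\tfrac{1}{2(2n-1)}\bigl[g(X,Y)\theta_1(Z)-g(X,Z)\theta_1(Y)-g(X,J_1Y)\theta_1(J_1Z)+g(X,J_1Z)\theta_1(J_1Y)\bigr],$$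 $$F_\alpha(X,Y,Z)=\tfrac{1}{4n}\bigl[g(X,Y)\theta_\alpha(Z)+g(X,Z)\theta_\alpha(Y)+g(X,J_\alpha Y)\theta_\alpha(J_\alpha Z)+g(X,J_\alpha Z)\theta_\alpha(J_\alpha Y)\bigr]\quad(\alpha=2,3).$$ Let $\overline M$ be a $\mathcal W$-manifold of dimension $4n$, with structure $(J_1,J_2,J_3,g)$ and Lee forms $\overline\theta_\alpha$, and let $M$ be a (possibly only immersed) holomorphic submanifold of $\overline M$ of dimension $4m$, $0<m<n$; that is, $J_\alpha(T_pM)=T_pM$ for all $p\in M$ and $\alpha=1,2,3$, and the restriction of $g$ to every $T_pM$ is nondegenerate. Suppose that $M$ is totally geodesic, that is, its second fundamental form $h(X,Y)=\overline\nabla_XY-\nabla_XY$ vanishes, where $\overline\nabla$ and $\nabla$ are the Levi-Civita connections of $\overline M$ and of $M$ with the restricted metric. Then $M$, with the restrictions of $J_1,J_2,J_3$ and $g$, is a $\mathcal W$-manifold. Moreover, for $\alpha=1,2,3$, the Lee form $\theta_\alpha$ of $M$ is non-zero at every point of $M$ at which $\overline\theta_\alpha$ is non-zero. -/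

import Mathlib

open scoped Manifold ContDiff Bundle

noncomputable section

/- Throughout, a manifold `M` is modelled on a finite-dimensional real vector space `E`, without
boundary, and `TangentSpace 𝓘(ℝ, E) p` is its tangent space at `p`.  The three almost complex
structures `J₁, J₂, J₃` are indexed by `0, 1, 2 : Fin 3`. -/

/-- A field of bilinear forms on the tangent spaces of `M`. -/
abbrev BilinField (E : Type*) [NormedAddCommGroup E] [NormedSpace ℝ E]
    (M : Type*) [TopologicalSpace M] [ChartedSpace E M] :=
  (p : M) → TangentSpace 𝓘(ℝ, E) p →L[ℝ] TangentSpace 𝓘(ℝ, E) p →L[ℝ] ℝ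

/-- A field of endomorphisms of the tangent spaces of `M`. -/
abbrev EndField (E : Type*) [NormedAddCommGroup E] [NormedSpace ℝ E]
    (M : Type*) [TopologicalSpace M] [ChartedSpace E M] :=
  (p : M) → TangentSpace 𝓘(ℝ, E) p →L[ℝ] TangentSpace 𝓘(ℝ, E) p

section LeviCivita

variable {E : Type*} [NormedAddCommGroup E] [NormedSpace ℝ E]
  {M : Type*} [TopologicalSpace M] [ChartedSpace E M] [IsManifold 𝓘(ℝ, E) ∞ M]

/-- A smooth pseudo-Riemannian metric: a smooth field of nondegenerate symmetric bilinear forms. -/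
structure IsPseudoRiemannianMetric (g : BilinField E M) : Prop where
  smooth : ContMDiff 𝓘(ℝ, E) (𝓘(ℝ, E).prod 𝓘(ℝ, E →L[ℝ] E →L[ℝ] ℝ)) ∞
    (fun p ↦ Bundle.TotalSpace.mk' (E →L[ℝ] E →L[ℝ] ℝ)
      (E := fun p : M ↦ TangentSpace 𝓘(ℝ, E) p →L[ℝ] TangentSpace 𝓘(ℝ, E) p →L[ℝ] ℝ) p (g p))
  symm : ∀ p v w, g p v w = g p w v
  nondegenerate : ∀ p v, (∀ w, g p v w = 0) → v = 0

/-- The matrix of the metric in the chart around `p`, as a function of the point `q` near `p`: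
`metricInChart g p q u v` is `g q` applied to the coordinate vector fields at `q` with
constant components `u` and `v`. -/
def metricInChart (g : BilinField E M) (p q : M) : E →L[ℝ] E →L[ℝ] ℝ :=
  ContinuousLinearMap.bilinearComp (E := E) (F := E) (g q)
    ((trivializationAt E (TangentSpace 𝓘(ℝ, E)) p).symmL ℝ q)
    ((trivializationAt E (TangentSpace 𝓘(ℝ, E)) p).symmL ℝ q)

/-- The derivative at `p` of the components of the metric in the chart around `p`:
`metricDeriv g p x u v = ∂ₓ (g (u, v))`, for coordinate vectors `x`, `u`, `v`. -/
def metricDeriv (g : BilinField E M) (p : M) : E →L[ℝ] E →L[ℝ] E →L[ℝ] ℝ :=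
  mvfderiv 𝓘(ℝ, E) (metricInChart g p) p

/-- The Christoffel symbols of the first kind at `p`, in the chart around `p`, as a linear form in
the last argument `z`: `½ (∂ₓ g(y, z) + ∂_y g(x, z) - ∂_z g(x, y))`. -/
def christoffelFirst (g : BilinField E M) (p : M) (x y : E) : E →L[ℝ] ℝ :=
  (1 / 2 : ℝ) • (metricDeriv g p x y + metricDeriv g p y x - ((metricDeriv g p).flip x).flip y)

/-- The Christoffel symbols `Γ(x, y)` of the Levi-Civita connection of `g` at `p` in the chart
around `p`, given by `g(Γ(x, y), z) = ½ (∂ₓ g(y, z) + ∂_y g(x, z) - ∂_z g(x, y))` for all `z`. -/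
def christoffel (g : BilinField E M) (p : M) (x y : E) : E :=
  (metricInChart g p p).inverse (christoffelFirst g p x y)

variable {E' : Type*} [NormedAddCommGroup E'] [NormedSpace ℝ E']
  {N : Type*} [TopologicalSpace N] [ChartedSpace E' N]

/-- The Levi-Civita covariant derivative on `(M, g)` of a vector field `V` along a map `f : N → M`
in the direction of `x : T_p N`.  In the chart of `M` around `f p` it is
`∂ₓ V + Γ(df x, V p)`. -/
def covDerivAlong (g : BilinField E M) (f : N → M)
    (V : (q : N) → TangentSpace 𝓘(ℝ, E) (f q)) (p : N) (x : TangentSpace 𝓘(ℝ, E') p) :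
    TangentSpace 𝓘(ℝ, E) (f p) :=
  (mvfderiv 𝓘(ℝ, E')
      (fun q ↦ (trivializationAt E (TangentSpace 𝓘(ℝ, E)) (f p)).continuousLinearMapAt ℝ (f q)
        (V q)) p x
    + christoffel g (f p) (mfderiv 𝓘(ℝ, E') 𝓘(ℝ, E) f p x) (V p) : E)

/-- The Levi-Civita connection of `g`: `leviCivita g Y p x` is `(∇ₓ Y)(p)`. -/
def leviCivita (g : BilinField E M) (Y : (q : M) → TangentSpace 𝓘(ℝ, E) q) (p : M)
    (x : TangentSpace 𝓘(ℝ, E) p) : TangentSpace 𝓘(ℝ, E) p :=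
  covDerivAlong g (fun q : M ↦ q) Y p x

/-- The covariant derivative `(∇ₓ J) y = ∇ₓ (J Y) - J (∇ₓ Y)` of a field of endomorphisms, where
`Y` is any local extension of `y`; here, the one with constant components in the chart at `p`. -/
def covDerivEnd (g : BilinField E M) (J : EndField E M) (p : M)
    (x y : TangentSpace 𝓘(ℝ, E) p) : TangentSpace 𝓘(ℝ, E) p :=
  leviCivita g (fun q ↦ J q (FiberBundle.extend E y q)) p x
    - J p (leviCivita g (FiberBundle.extend E y) p x)

/-- The fundamental tensor `F(x, y, z) = g((∇ₓ J) y, z)`. -/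
def fundamentalTensor (g : BilinField E M) (J : EndField E M) (p : M)
    (x y z : TangentSpace 𝓘(ℝ, E) p) : ℝ :=
  g p (covDerivEnd g J p x y) z

/-- The Lee form `θ(z) = gⁱʲ F(eᵢ, eⱼ, z)`, for a basis `(eᵢ)` of the tangent space, where `(gⁱʲ)`
is the inverse of the matrix `(g(eᵢ, eⱼ))`. -/
def leeForm [FiniteDimensional ℝ E] (g : BilinField E M) (J : EndField E M) (p : M)
    (z : TangentSpace 𝓘(ℝ, E) p) : ℝ :=
  let e : Fin (Module.finrank ℝ E) → TangentSpace 𝓘(ℝ, E) p := fun i ↦ Module.finBasis ℝ E i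
  ∑ i, ∑ j, (Matrix.of fun k l ↦ g p (e k) (e l))⁻¹ i j * fundamentalTensor g J p (e i) (e j) z

/-- The Nijenhuis tensor `[JX, JY] - J[JX, Y] - J[X, JY] - [X, Y]` of an almost complex structure,
evaluated on two vector fields. -/
def nijenhuis (J : EndField E M) (X Y : (p : M) → TangentSpace 𝓘(ℝ, E) p) (p : M) :
    TangentSpace 𝓘(ℝ, E) p :=
  VectorField.mlieBracket 𝓘(ℝ, E) (fun q ↦ J q (X q)) (fun q ↦ J q (Y q)) p
    - J p (VectorField.mlieBracket 𝓘(ℝ, E) (fun q ↦ J q (X q)) Y p)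
    - J p (VectorField.mlieBracket 𝓘(ℝ, E) X (fun q ↦ J q (Y q)) p)
    - VectorField.mlieBracket 𝓘(ℝ, E) X Y p

end LeviCivita

section HermitianNorden

variable {E : Type*} [NormedAddCommGroup E] [NormedSpace ℝ E]
  {M : Type*} [TopologicalSpace M] [ChartedSpace E M] [IsManifold 𝓘(ℝ, E) ∞ M]

/-- `(M, H, G)` is an almost hypercomplex manifold with Hermitian and Norden metrics, of dimension
`4 n`.  Only `H = (J₁, J₂, J₃)` and `g` are recorded: the other members of `G = (g, g₁, g₂, g₃)`
are the forms `g_α(x, y) = g(J_α x, y)`. -/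
structure IsAlmostHypercomplexHN (n : ℕ) (J : Fin 3 → EndField E M) (g : BilinField E M) :
    Prop where
  dim : Module.finrank ℝ E = 4 * n
  smooth : ∀ α, ContMDiff 𝓘(ℝ, E) (𝓘(ℝ, E).prod 𝓘(ℝ, E →L[ℝ] E)) ∞
    (fun p ↦ Bundle.TotalSpace.mk' (E →L[ℝ] E)
      (E := fun p : M ↦ TangentSpace 𝓘(ℝ, E) p →L[ℝ] TangentSpace 𝓘(ℝ, E) p) p (J α p))
  /-- `J_α² = -I` -/
  sq : ∀ α p x, J α p (J α p x) = -x
  /-- `J_α = J_β J_γ` for the cyclic permutations `(α, β, γ)` of the indices -/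
  comp : ∀ α p x, J (α + 1) p (J (α + 2) p x) = J α p x
  /-- `J_α = -J_γ J_β` for the cyclic permutations `(α, β, γ)` of the indices -/
  comp_rev : ∀ α p x, J (α + 2) p (J (α + 1) p x) = -J α p x
  metric : IsPseudoRiemannianMetric g
  hermitian : ∀ p x y, g p (J 0 p x) (J 0 p y) = g p x y
  norden_two : ∀ p x y, g p (J 1 p x) (J 1 p y) = -g p x y
  norden_three : ∀ p x y, g p (J 2 p x) (J 2 p y) = -g p x y

/-- `(M, H, G)` is a `𝒲`-manifold of dimension `4 n`: it is hypercomplex, and its fundamental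
tensors are expressed through the Lee forms as in the Gray–Hervella class `𝒲₄` (for `J₁`), and as
in the class `𝒲₁` of manifolds with Norden metric (for `J₂` and `J₃`). -/
structure IsWManifold [FiniteDimensional ℝ E] (n : ℕ) (J : Fin 3 → EndField E M)
    (g : BilinField E M) : Prop extends IsAlmostHypercomplexHN n J g where
  integrable : ∀ α (X Y : (p : M) → TangentSpace 𝓘(ℝ, E) p) (p : M),
    MDifferentiableAt 𝓘(ℝ, E) 𝓘(ℝ, E).tangent
      (fun q ↦ (⟨q, X q⟩ : TangentBundle 𝓘(ℝ, E) M)) p →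
    MDifferentiableAt 𝓘(ℝ, E) 𝓘(ℝ, E).tangent
      (fun q ↦ (⟨q, Y q⟩ : TangentBundle 𝓘(ℝ, E) M)) p →
    nijenhuis (J α) X Y p = 0
  fundamental_one : ∀ p x y z,
    fundamentalTensor g (J 0) p x y z = 1 / (2 * (2 * (n : ℝ) - 1)) *
      (g p x y * leeForm g (J 0) p z - g p x z * leeForm g (J 0) p y
        - g p x (J 0 p y) * leeForm g (J 0) p (J 0 p z)
        + g p x (J 0 p z) * leeForm g (J 0) p (J 0 p y))
  fundamental_norden : ∀ α, α ≠ 0 → ∀ p x y z,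
    fundamentalTensor g (J α) p x y z = 1 / (4 * (n : ℝ)) *
      (g p x y * leeForm g (J α) p z + g p x z * leeForm g (J α) p y
        + g p x (J α p y) * leeForm g (J α) p (J α p z)
        + g p x (J α p z) * leeForm g (J α) p (J α p y))

end HermitianNorden

section Submanifold

variable {E : Type*} [NormedAddCommGroup E] [NormedSpace ℝ E]
  {M : Type*} [TopologicalSpace M] [ChartedSpace E M]
  {E' : Type*} [NormedAddCommGroup E'] [NormedSpace ℝ E']
  {M' : Type*} [TopologicalSpace M'] [ChartedSpace E' M']

/-- The restriction of the metric to a submanifold `ι : M → M'`. -/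
def inducedMetric (ι : M → M') (g : BilinField E' M') : BilinField E M := fun p ↦
  ContinuousLinearMap.bilinearComp (E := E') (F := E') (E' := E) (F' := E) (g (ι p))
    (mfderiv 𝓘(ℝ, E) 𝓘(ℝ, E') ι p) (mfderiv 𝓘(ℝ, E) 𝓘(ℝ, E') ι p)

/-- The restriction of a field of endomorphisms to a submanifold `ι : M → M'` with invariant tangent
spaces: the vector `inducedEnd ι J p x` is the `w` with `dι w = J (dι x)`
(see `mfderiv_inducedEnd`). -/
def inducedEnd [FiniteDimensional ℝ E] (ι : M → M') (J : EndField E' M') : EndField E M := fun p ↦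
  let dι := (mfderiv 𝓘(ℝ, E) 𝓘(ℝ, E') ι p).toLinearMap
  haveI : FiniteDimensional ℝ (TangentSpace 𝓘(ℝ, E) p) := ‹FiniteDimensional ℝ E›
  haveI : T2Space (TangentSpace 𝓘(ℝ, E) p) := inferInstanceAs (T2Space E)
  { toLinearMap := dι.leftInverse ∘ₗ (J (ι p)).toLinearMap ∘ₗ dι
    cont := LinearMap.continuous_of_finiteDimensional _ }

/-- `ι : M → M'` is a (possibly just immersed) holomorphic submanifold of dimension `4 m` of the
`4 n`-dimensional manifold `(M', H, G)`. -/
structure IsHolomorphicSubmanifold (m n : ℕ) (ι : M → M') (J : Fin 3 → EndField E' M')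
    (g : BilinField E' M') : Prop where
  pos : 0 < m
  lt : m < n
  dim : Module.finrank ℝ E = 4 * m
  smooth : ContMDiff 𝓘(ℝ, E) 𝓘(ℝ, E') ∞ ι
  immersion : ∀ p, Function.Injective (mfderiv 𝓘(ℝ, E) 𝓘(ℝ, E') ι p)
  /-- `J_α (T_p M) = T_p M` -/
  invariant : ∀ α p, Submodule.map (J α (ι p)).toLinearMap
      (LinearMap.range (mfderiv 𝓘(ℝ, E) 𝓘(ℝ, E') ι p).toLinearMap) =
    LinearMap.range (mfderiv 𝓘(ℝ, E) 𝓘(ℝ, E') ι p).toLinearMap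
  /-- the restriction of `g` to `T_p M` has maximal rank -/
  nondegenerate : ∀ p v, (∀ w, inducedMetric (E := E) ι g p v w = 0) → v = 0

theorem mfderiv_inducedEnd [FiniteDimensional ℝ E] {m n : ℕ} {ι : M → M'}
    {J : Fin 3 → EndField E' M'} {g : BilinField E' M'}
    (h : IsHolomorphicSubmanifold (E := E) m n ι J g) (α : Fin 3) (p : M)
    (x : TangentSpace 𝓘(ℝ, E) p) :
    mfderiv 𝓘(ℝ, E) 𝓘(ℝ, E') ι p (inducedEnd ι (J α) p x) =
      J α (ι p) (mfderiv 𝓘(ℝ, E) 𝓘(ℝ, E') ι p x) := by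
  have hx : J α (ι p) (mfderiv 𝓘(ℝ, E) 𝓘(ℝ, E') ι p x) ∈
      LinearMap.range (mfderiv 𝓘(ℝ, E) 𝓘(ℝ, E') ι p).toLinearMap := by
    rw [← h.invariant α p]
    exact ⟨_, ⟨x, rfl⟩, rfl⟩
  obtain ⟨w, hw⟩ := hx
  have hw' : mfderiv 𝓘(ℝ, E) 𝓘(ℝ, E') ι p w =
    J α (ι p) (mfderiv 𝓘(ℝ, E) 𝓘(ℝ, E') ι p x) := hw
  have hk : LinearMap.ker (mfderiv 𝓘(ℝ, E) 𝓘(ℝ, E') ι p).toLinearMap = ⊥ :=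
    LinearMap.ker_eq_bot.2 (h.immersion p)
  have : inducedEnd ι (J α) p x = w := by
    change (mfderiv 𝓘(ℝ, E) 𝓘(ℝ, E') ι p).toLinearMap.leftInverse
      (J α (ι p) (mfderiv 𝓘(ℝ, E) 𝓘(ℝ, E') ι p x)) = w
    rw [← hw']
    exact LinearMap.leftInverse_apply_of_inj hk w
  rw [this, hw']

variable [IsManifold 𝓘(ℝ, E) ∞ M] [IsManifold 𝓘(ℝ, E') ∞ M']

/-- The second fundamental form `h(X, Y) = ∇'_X Y - ∇_X Y` of `ι : M → M'` at `p`, evaluated on a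
vector `x` and a vector field `Y`, where `∇'` and `∇` are the Levi-Civita connections of `g`
and of the induced metric. -/
def secondFundamentalForm (ι : M → M') (g : BilinField E' M')
    (Y : (q : M) → TangentSpace 𝓘(ℝ, E) q) (p : M) (x : TangentSpace 𝓘(ℝ, E) p) :
    TangentSpace 𝓘(ℝ, E') (ι p) :=
  covDerivAlong g ι (fun q ↦ mfderiv 𝓘(ℝ, E) 𝓘(ℝ, E') ι q (Y q)) p x
    - mfderiv 𝓘(ℝ, E) 𝓘(ℝ, E') ι p (leviCivita (inducedMetric ι g) Y p x)

/-- The submanifold `ι : M → M'` is totally geodesic: its second fundamental form vanishes. -/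
def IsTotallyGeodesic (E : Type*) [NormedAddCommGroup E] [NormedSpace ℝ E]
    {M : Type*} [TopologicalSpace M] [ChartedSpace E M] [IsManifold 𝓘(ℝ, E) ∞ M]
    (ι : M → M') (g : BilinField E' M') : Prop :=
  ∀ (Y : (q : M) → TangentSpace 𝓘(ℝ, E) q) (p : M) (x : TangentSpace 𝓘(ℝ, E) p),
    MDifferentiableAt 𝓘(ℝ, E) 𝓘(ℝ, E).tangent
      (fun q ↦ (⟨q, Y q⟩ : TangentBundle 𝓘(ℝ, E) M)) p →
    secondFundamentalForm ι g Y p x = 0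

end Submanifold

end

/-! Write `δ = -1` for `J₁` and `δ = 1` for `J₂`, `J₃`. All three conditions on the fundamental
tensors then take a single form: `F(x, y, z) = c (g(x, y) θ(z) + δ g(x, z) θ(y) + δ g(x, J y) θ(J z)
+ g(x, J z) θ(J y))`, with `c = c_n = 1 / (4n + δ - 1)`.

In a totally geodesic invariant submanifold, `dι` intertwines the covariant derivatives of the
induced and ambient `J` (`mfderiv_covDerivEnd`). So the induced `F` is the pullback of the ambient
one and has the same form, with the ambient constant `c_n` and with the pullback of the ambient Lee
form in place of `θ`. Contracting in dimension `4m` shows that the Lee form of the submanifold is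
`c_n / c_m` times that pullback (`leeForm_eq_of_isConformalType`), which turns the formula into the
one with constant `c_m`. Integrability is also read off from it: the Nijenhuis tensor is an
expression in `∇J` that vanishes for any `F` of this form (`nijenhuis_eq_zero_of_isConformalType`).

For the last claim, let `ξ` be normal. Derivatives of `J` along tangent vectors are tangent, so
`F(x, y, ξ) = 0` for tangent `x`, `y`, and the formula reduces to `θ(ξ) y + δ θ(J ξ) J y = 0`. Since
`y` and `J y` are independent, `θ(ξ) = 0` (`eq_zero_of_normal`). The ambient Lee form thus lives on
the tangent part, and it vanishes as soon as its pullback does. -/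

noncomputable section

/-! ### Contraction with the inverse Gram matrix -/

section Contraction

variable {V : Type*} [AddCommGroup V] [Module ℝ V] {k : ℕ} (b : Module.Basis (Fin k) ℝ V)
  {B : LinearMap.BilinForm ℝ V}

/-- Contracting `B(x, A y)` with the inverse Gram matrix of `B` gives the trace of `A`. -/
theorem sum_gram_inv_mul_eq_trace (hs : ∀ x y, B x y = B y x)
    (hn : ∀ x, (∀ y, B x y = 0) → x = 0) (A : V →ₗ[ℝ] V) :
    ∑ i, ∑ j, (Matrix.of fun k l ↦ B (b k) (b l))⁻¹ i j * B (b i) (A (b j)) =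
      LinearMap.trace ℝ V A := by
  set G : Matrix (Fin k) (Fin k) ℝ := Matrix.of fun k l ↦ B (b k) (b l) with hG
  have hnd : B.Nondegenerate :=
    ⟨fun x hx ↦ hn x hx, fun x hx ↦ hn x fun y ↦ (hs x y).trans (hx y)⟩
  have hdet : IsUnit G.det := by
    have h := (LinearMap.BilinForm.nondegenerate_iff_det_ne_zero b).1 hnd
    have hGB : LinearMap.BilinForm.toMatrix b B = G := by
      ext i j
      simp [hG, LinearMap.BilinForm.toMatrix_apply]
    rw [hGB] at h
    exact h.isUnit
  have hA : ∀ i j, B (b i) (A (b j)) = (G * LinearMap.toMatrix b b A) i j := by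
    intro i j
    rw [← congrArg (B (b i)) (b.sum_repr (A (b j))), map_sum]
    simp only [Matrix.mul_apply, hG, LinearMap.toMatrix_apply, Matrix.of_apply, map_smul,
      smul_eq_mul, mul_comm]
  have hGt : G.transpose = G := by
    ext i j
    simp [hG, hs (b j) (b i)]
  -- The diagonal of `G⁻¹ (G A)` pairs `G⁻¹ j i` with `(G A) i j`; symmetry of `G⁻¹` matches this to
  -- the index order of the contraction.
  have hinv : ∀ i j, G⁻¹ i j = G⁻¹ j i := by
    intro i j
    rw [← Matrix.transpose_apply G⁻¹, Matrix.transpose_nonsing_inv, hGt]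
  rw [LinearMap.trace_eq_matrix_trace ℝ b, Finset.sum_comm, Matrix.trace]
  refine Finset.sum_congr rfl fun j _ ↦ ?_
  rw [Matrix.diag_apply]
  conv_rhs => rw [← Matrix.nonsing_inv_mul_cancel_left G (LinearMap.toMatrix b b A) hdet]
  rw [Matrix.mul_apply]
  exact Finset.sum_congr rfl fun i _ ↦ by rw [hA, hinv]

/-- Contracting `x` and `y` in the tensor `B(x, y) t(z) + δ B(x, z) t(y) + δ B(x, J y) t(J z) +
B(x, J z) t(J y)` gives a multiple of `t`. -/
theorem sum_gram_inv_mul_fundamental [FiniteDimensional ℝ V] (hs : ∀ x y, B x y = B y x)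
    (hn : ∀ x, (∀ y, B x y = 0) → x = 0) {J : V →ₗ[ℝ] V} (hJ : ∀ x, J (J x) = -x)
    (htr : LinearMap.trace ℝ V J = 0) (t : V →ₗ[ℝ] ℝ) (δ c : ℝ) (z : V) :
    ∑ i, ∑ j, (Matrix.of fun k l ↦ B (b k) (b l))⁻¹ i j *
        (c * (B (b i) (b j) * t z + δ * (B (b i) z * t (b j))
          + δ * (B (b i) (J (b j)) * t (J z)) + B (b i) (J z) * t (J (b j)))) =
      c * (k + δ - 1) * t z := by
  -- The tensor is `B(x, A y)` for this `A`. The four summands have traces `k t(z)`, `δ t(z)`, `0`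
  -- (as `tr J = 0`) and `t(J (J z)) = -t(z)`, whence the factor `k + δ - 1`.
  have h := sum_gram_inv_mul_eq_trace b hs hn
    (c • (t z • LinearMap.id + δ • t.smulRight z + (δ * t (J z)) • J
      + (t ∘ₗ J).smulRight (J z)))
  have hk : Module.finrank ℝ V = k := by simpa using Module.finrank_eq_card_basis b
  simp only [map_smul, map_add, htr, LinearMap.trace_id, LinearMap.trace_smulRight, hk,
    smul_eq_mul, LinearMap.comp_apply, hJ, map_neg, mul_zero] at h
  rw [show c * (k + δ - 1) * t z = c * (t z * k + δ * t z + 0 + -t z) by ring, ← h]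
  refine Finset.sum_congr rfl fun i _ ↦ Finset.sum_congr rfl fun j _ ↦ ?_
  simp only [LinearMap.smul_apply, LinearMap.add_apply, LinearMap.id_apply, map_add, map_smul,
    LinearMap.smulRight_apply, LinearMap.comp_apply, smul_eq_mul]
  ring

end Contraction

/-! ### Pointwise linear algebra -/

section LinearAlgebra

variable {V : Type*} [AddCommGroup V] [Module ℝ V]

/-- A vector and its image under a complex structure are linearly independent. -/
theorem eq_zero_of_smul_eq_smul_complexStructure {J : V →ₗ[ℝ] V} (hJ : ∀ x, J (J x) = -x) {v : V}
    (hv : v ≠ 0) {a b : ℝ} (h : a • v = b • J v) : a = 0 := by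
  have h1 : a • J v = -(b • v) := by simpa [hJ] using congrArg J h
  have h2 : (a * a + b * b) • v = 0 := by
    rw [add_smul, mul_smul, h, smul_comm, h1, smul_neg, smul_smul, neg_add_cancel]
  have := (smul_eq_zero.1 h2).resolve_right hv
  nlinarith

/-- Orthogonal projection to a subspace on which the form is nondegenerate. -/
theorem exists_add_orthogonal {W : Type*} [AddCommGroup W] [Module ℝ W] [FiniteDimensional ℝ V]
    (B : LinearMap.BilinForm ℝ W) (f : V →ₗ[ℝ] W)
    (hn : ∀ x, (∀ y, B (f x) (f y) = 0) → x = 0) (w : W) :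
    ∃ x, ∀ y, B (w - f x) (f y) = 0 := by
  -- Nondegeneracy on the image of `f` makes `Φ` injective, hence onto the dual by dimension; `x` is
  -- then the vector representing `B w ∘ f`.
  let Φ : V →ₗ[ℝ] Module.Dual ℝ V := B.compl₁₂ f f
  have hinj : Function.Injective Φ := by
    rw [← LinearMap.ker_eq_bot, LinearMap.ker_eq_bot']
    exact fun x hx ↦ hn x fun y ↦ LinearMap.congr_fun hx y
  have hsurj : Function.Surjective Φ :=
    (LinearMap.injective_iff_surjective_of_finrank_eq_finrank Subspace.dual_finrank_eq.symm).1 hinj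
  obtain ⟨x, hx⟩ := hsurj ((B w) ∘ₗ f)
  refine ⟨x, fun y ↦ ?_⟩
  have : B (f x) (f y) = B w (f y) := LinearMap.congr_fun hx y
  simp [this]

/-- The trace of an endomorphism that is the product of two anticommuting ones vanishes. -/
theorem trace_eq_zero_of_anticommute [FiniteDimensional ℝ V] {A B C : V →ₗ[ℝ] V}
    (h : ∀ x, A (B x) = C x) (h' : ∀ x, B (A x) = -C x) : LinearMap.trace ℝ V C = 0 := by
  have h1 : A * B = C := LinearMap.ext h
  have h2 : B * A = -C := LinearMap.ext h'
  have := LinearMap.trace_mul_comm ℝ A B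
  rw [h1, h2, map_neg] at this
  linarith

end LinearAlgebra

/-! ### Tensor fields in a chart -/

section Chart

theorem eventually_mem_chart_source {E : Type*} [TopologicalSpace E] {M : Type*}
    [TopologicalSpace M] [ChartedSpace E M] (p : M) : ∀ᶠ q in nhds p, q ∈ (chartAt E p).source :=
  (chartAt E p).open_source.mem_nhds (mem_chart_source E p)

variable {E : Type*} [NormedAddCommGroup E] [NormedSpace ℝ E]
  {M : Type*} [TopologicalSpace M] [ChartedSpace E M] [IsManifold 𝓘(ℝ, E) ∞ M]
  {E' : Type*} [NormedAddCommGroup E'] [NormedSpace ℝ E']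
  {N : Type*} [TopologicalSpace N] [ChartedSpace E' N]
  {F : Type*} [NormedAddCommGroup F] [NormedSpace ℝ F]
  {G : Type*} [NormedAddCommGroup G] [NormedSpace ℝ G]

/-- The components at `q`, in the chart around `p`, of a tangent vector. -/
def toChart (p q : M) : TangentSpace 𝓘(ℝ, E) q →L[ℝ] E :=
  (trivializationAt E (TangentSpace 𝓘(ℝ, E)) p).continuousLinearMapAt ℝ q

/-- The tangent vector at `q` with given components in the chart around `p`. -/
def ofChart (p q : M) : E →L[ℝ] TangentSpace 𝓘(ℝ, E) q :=
  (trivializationAt E (TangentSpace 𝓘(ℝ, E)) p).symmL ℝ q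

theorem ofChart_toChart {p q : M} (hq : q ∈ (chartAt E p).source) (v : TangentSpace 𝓘(ℝ, E) q) :
    ofChart p q (toChart p q v) = v :=
  (trivializationAt E (TangentSpace 𝓘(ℝ, E)) p).symmL_continuousLinearMapAt hq v

theorem toChart_ofChart {p q : M} (hq : q ∈ (chartAt E p).source) (v : E) :
    toChart p q (ofChart (E := E) p q v) = v :=
  (trivializationAt E (TangentSpace 𝓘(ℝ, E)) p).continuousLinearMapAt_symmL hq v

/-- At its own centre the preferred trivialization is the identity, so tangent vectors at `p`
coincide with their components. -/
theorem toChart_self (p : M) (v : TangentSpace 𝓘(ℝ, E) p) : toChart p p v = v := by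
  have h := TangentBundle.continuousLinearMapAt_trivializationAt_eq_core (I := 𝓘(ℝ, E))
    (mem_chart_source E p)
  rw [toChart, h]
  exact (tangentBundleCore 𝓘(ℝ, E) M).coordChange_self _ _ (mem_chart_source E p) v

theorem ofChart_self (p : M) (v : E) : ofChart p p v = (v : TangentSpace 𝓘(ℝ, E) p) := by
  rw [← toChart_self p (ofChart p p v), toChart_ofChart (mem_chart_source E p)]

theorem toChart_eq_snd {p q : M} (hq : q ∈ (chartAt E p).source) (v : TangentSpace 𝓘(ℝ, E) q) :
    toChart p q v = (trivializationAt E (TangentSpace 𝓘(ℝ, E)) p ⟨q, v⟩).2 := by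
  rw [toChart, Bundle.Trivialization.continuousLinearMapAt_apply,
    Bundle.Trivialization.coe_linearMapAt_of_mem _ hq]

/-- A vector field is differentiable if and only if its components in a chart are. -/
theorem mdifferentiableAt_toChart_iff (X : (q : M) → TangentSpace 𝓘(ℝ, E) q) (p : M) :
    MDifferentiableAt 𝓘(ℝ, E) 𝓘(ℝ, E).tangent
      (fun q ↦ (⟨q, X q⟩ : TangentBundle 𝓘(ℝ, E) M)) p ↔
    MDifferentiableAt 𝓘(ℝ, E) 𝓘(ℝ, E) (fun q ↦ toChart p q (X q)) p := by
  have h := mdifferentiableAt_section (IB := 𝓘(ℝ, E)) (F := E) X (b₀ := p)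
  refine h.trans (Filter.EventuallyEq.mdifferentiableAt_iff ?_)
  filter_upwards [eventually_mem_chart_source (E := E) p] with q hq
  exact (toChart_eq_snd hq _).symm

/-- The matrix of a field of endomorphisms in the chart around `p`. -/
def endInChart (J : EndField E M) (p q : M) : E →L[ℝ] E :=
  (toChart p q).comp ((J q).comp (ofChart p q))

theorem toChart_apply_end (J : EndField E M) {p q : M} (hq : q ∈ (chartAt E p).source)
    (v : TangentSpace 𝓘(ℝ, E) q) : toChart p q (J q v) = endInChart J p q (toChart p q v) := by
  simp [endInChart, ofChart_toChart hq]

theorem metricInChart_apply (g : BilinField E M) (p q : M) (u v : E) :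
    metricInChart g p q u v = g q (ofChart p q u) (ofChart p q v) := rfl

theorem metricInChart_toChart (g : BilinField E M) {p q : M} (hq : q ∈ (chartAt E p).source)
    (u v : TangentSpace 𝓘(ℝ, E) q) :
    metricInChart g p q (toChart p q u) (toChart p q v) = g q u v := by
  rw [metricInChart_apply, ofChart_toChart hq, ofChart_toChart hq]

theorem contMDiffAt_endField_iff (J : EndField E M) (p : M) :
    ContMDiffAt 𝓘(ℝ, E) (𝓘(ℝ, E).prod 𝓘(ℝ, E →L[ℝ] E)) ∞
      (fun p ↦ Bundle.TotalSpace.mk' (E →L[ℝ] E)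
        (E := fun p : M ↦ TangentSpace 𝓘(ℝ, E) p →L[ℝ] TangentSpace 𝓘(ℝ, E) p) p (J p)) p ↔
    ContMDiffAt 𝓘(ℝ, E) 𝓘(ℝ, E →L[ℝ] E) ∞ (endInChart J p) p := by
  rw [contMDiffAt_hom_bundle]
  exact ⟨fun h ↦ h.2, fun h ↦ ⟨contMDiffAt_id, h⟩⟩

/-- Near `p` the coordinates of the iterated hom bundle are those of `metricInChart`, the trivial
factor `ℝ` contributing nothing. -/
theorem contMDiffAt_bilinField_iff (g : BilinField E M) (p : M) :
    ContMDiffAt 𝓘(ℝ, E) (𝓘(ℝ, E).prod 𝓘(ℝ, E →L[ℝ] E →L[ℝ] ℝ)) ∞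
      (fun p ↦ Bundle.TotalSpace.mk' (E →L[ℝ] E →L[ℝ] ℝ)
        (E := fun p : M ↦ TangentSpace 𝓘(ℝ, E) p →L[ℝ] TangentSpace 𝓘(ℝ, E) p →L[ℝ] ℝ)
        p (g p)) p ↔
    ContMDiffAt 𝓘(ℝ, E) 𝓘(ℝ, E →L[ℝ] E →L[ℝ] ℝ) ∞ (metricInChart g p) p := by
  rw [contMDiffAt_hom_bundle]
  have h : (fun q ↦ ContinuousLinearMap.inCoordinates E (TangentSpace 𝓘(ℝ, E)) (E →L[ℝ] ℝ)
      (fun q : M ↦ TangentSpace 𝓘(ℝ, E) q →L[ℝ] ℝ) p q p q (g q)) =ᶠ[nhds p]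
      metricInChart g p := by
    filter_upwards [eventually_mem_chart_source (E := E) p] with q hq
    ext u v
    rw [metricInChart_apply]
    refine (inCoordinates_apply_eq₂ (F₃ := ℝ) (E₃ := fun _ : M ↦ ℝ) hq hq
      (Set.mem_univ _)).trans ?_
    have hb : q ∈ (trivializationAt E (TangentSpace 𝓘(ℝ, E)) p).baseSet := hq
    simp [ofChart, Bundle.Trivialization.symmL_apply _ hb]
  exact ⟨fun hg ↦ hg.2.congr_of_eventuallyEq h.symm,
    fun hg ↦ ⟨contMDiffAt_id, hg.congr_of_eventuallyEq h⟩⟩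

/-- The product rule for `mvfderiv`. -/
theorem mvfderiv_clm_apply {A : N → F →L[ℝ] G} {v : N → F} {p : N}
    (hA : MDifferentiableAt 𝓘(ℝ, E') 𝓘(ℝ, F →L[ℝ] G) A p)
    (hv : MDifferentiableAt 𝓘(ℝ, E') 𝓘(ℝ, F) v p) (x : TangentSpace 𝓘(ℝ, E') p) :
    mvfderiv 𝓘(ℝ, E') (fun q ↦ A q (v q)) p x =
      A p (mvfderiv 𝓘(ℝ, E') v p x) + mvfderiv 𝓘(ℝ, E') A p x (v p) := by
  let A' : E' →L[ℝ] F →L[ℝ] G := mvfderiv 𝓘(ℝ, E') A p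
  let v' : E' →L[ℝ] F := mvfderiv 𝓘(ℝ, E') v p
  have h1 : HasFDerivWithinAt (A ∘ (extChartAt 𝓘(ℝ, E') p).symm) A'
      (Set.range 𝓘(ℝ, E')) (extChartAt 𝓘(ℝ, E') p p) := hA.hasMFDerivAt.2
  have h2 : HasFDerivWithinAt (v ∘ (extChartAt 𝓘(ℝ, E') p).symm) v'
      (Set.range 𝓘(ℝ, E')) (extChartAt 𝓘(ℝ, E') p p) := hv.hasMFDerivAt.2
  have h3 := h1.clm_apply h2
  simp only [Function.comp_apply, extChartAt_to_inv] at h3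
  have h4 : HasMFDerivAt 𝓘(ℝ, E') 𝓘(ℝ, G) (fun q ↦ A q (v q)) p
      (A p ∘L v' + A'.flip (v p)) := ⟨hA.continuousAt.clm_apply hv.continuousAt, h3⟩
  have h5 : mvfderiv 𝓘(ℝ, E') (fun q ↦ A q (v q)) p = A p ∘L v' + A'.flip (v p) := h4.mfderiv
  rw [h5]
  rfl

end Chart

/-! ### Covariant derivatives, Lie brackets and the Nijenhuis tensor -/

section CovariantDerivative

variable {E : Type*} [NormedAddCommGroup E] [NormedSpace ℝ E]
  {M : Type*} [TopologicalSpace M] [ChartedSpace E M] [IsManifold 𝓘(ℝ, E) ∞ M]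
  {E' : Type*} [NormedAddCommGroup E'] [NormedSpace ℝ E']
  {N : Type*} [TopologicalSpace N] [ChartedSpace E' N]

theorem Filter.EventuallyEq.mvfderiv_eq {F : Type*} [NormedAddCommGroup F] [NormedSpace ℝ F]
    {u v : N → F} {p : N} (h : u =ᶠ[nhds p] v) :
    mvfderiv 𝓘(ℝ, E') u p = mvfderiv 𝓘(ℝ, E') v p :=
  h.mfderiv_eq (I := 𝓘(ℝ, E')) (I' := 𝓘(ℝ, F))

theorem covDerivAlong_apply (g : BilinField E M) (f : N → M)
    (V : (q : N) → TangentSpace 𝓘(ℝ, E) (f q)) (p : N) (x : TangentSpace 𝓘(ℝ, E') p) :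
    covDerivAlong g f V p x = (mvfderiv 𝓘(ℝ, E') (fun q ↦ toChart (f p) (f q) (V q)) p x
      + christoffel g (f p) (mfderiv 𝓘(ℝ, E') 𝓘(ℝ, E) f p x) (V p) : E) := rfl

theorem endInChart_self (J : EndField E M) (p : M) (v : E) :
    endInChart J p p v = J p (v : TangentSpace 𝓘(ℝ, E) p) := by
  rw [endInChart, ContinuousLinearMap.comp_apply, ContinuousLinearMap.comp_apply, toChart_self,
    ofChart_self]

/-- The derivative of a field of endomorphisms `J` in a chart: `(∂ₐ J) v + Γ(a, J v) - J Γ(a, v)`. -/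
def covDerivEndInChart (g : BilinField E M) (J : EndField E M) (p : M) (a v : E) : E :=
  mvfderiv 𝓘(ℝ, E) (endInChart J p) p a v + christoffel g p a (endInChart J p p v)
    - endInChart J p p (christoffel g p a v)

/-- The product rule for the covariant derivative of `J V` along a map. -/
theorem covDerivAlong_end_sub (g : BilinField E M) {J : EndField E M} {f : N → M} {p : N}
    (hJ : MDifferentiableAt 𝓘(ℝ, E) 𝓘(ℝ, E →L[ℝ] E) (endInChart J (f p)) (f p))
    (hf : MDifferentiableAt 𝓘(ℝ, E') 𝓘(ℝ, E) f p)
    {V : (q : N) → TangentSpace 𝓘(ℝ, E) (f q)}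
    (hV : MDifferentiableAt 𝓘(ℝ, E') 𝓘(ℝ, E) (fun q ↦ toChart (f p) (f q) (V q)) p)
    (x : TangentSpace 𝓘(ℝ, E') p) :
    covDerivAlong g f (fun q ↦ J (f q) (V q)) p x - J (f p) (covDerivAlong g f V p x) =
      covDerivEndInChart g J (f p) (mfderiv 𝓘(ℝ, E') 𝓘(ℝ, E) f p x) (V p) := by
  have h1 : (fun q ↦ toChart (f p) (f q) (J (f q) (V q))) =ᶠ[nhds p]
      fun q ↦ (endInChart J (f p) ∘ f) q (toChart (f p) (f q) (V q)) := by
    filter_upwards [hf.continuousAt.eventually (eventually_mem_chart_source (E := E) (f p))]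
      with q hq
    exact toChart_apply_end J hq _
  have h2 : mvfderiv 𝓘(ℝ, E') (endInChart J (f p) ∘ f) p x =
      mvfderiv 𝓘(ℝ, E) (endInChart J (f p)) (f p) (mfderiv 𝓘(ℝ, E') 𝓘(ℝ, E) f p x) :=
    mfderiv_comp_apply p hJ hf x
  let a : E := mfderiv 𝓘(ℝ, E') 𝓘(ℝ, E) f p x
  let A : E →L[ℝ] E := endInChart J (f p) (f p)
  let u : E := mvfderiv 𝓘(ℝ, E') (fun q ↦ toChart (f p) (f q) (V q)) p x
  have e1 : covDerivAlong g f (fun q ↦ J (f q) (V q)) p x =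
      (A u + mvfderiv 𝓘(ℝ, E) (endInChart J (f p)) (f p) a (V p)
        + christoffel g (f p) a (A (V p)) : E) := by
    have hA : A (V p) = J (f p) (V p) := endInChart_self J (f p) (V p)
    rw [hA, covDerivAlong_apply, h1.mvfderiv_eq, mvfderiv_clm_apply (hJ.comp p hf) hV, h2,
      toChart_self]
    rfl
  have e2 : J (f p) (covDerivAlong g f V p x) = (A u + A (christoffel g (f p) a (V p)) : E) := by
    rw [← map_add, covDerivAlong_apply]
    exact (endInChart_self J (f p) _).symm
  -- The term `A u`, which carries the derivative of `V`, cancels; what remains depends only on `V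
  -- p`.
  have e3 : ∀ b c d e : E, b + c + d - (b + e) = c + d - e := fun b c d e ↦ by abel
  rw [e1, e2]
  exact e3 _ _ _ _

/-- The product rule along the identity map shows that the extension of `y` used in `covDerivEnd`
enters only through its value at `p`. -/
theorem covDerivEnd_eq (g : BilinField E M) {J : EndField E M} {p : M}
    (hJ : MDifferentiableAt 𝓘(ℝ, E) 𝓘(ℝ, E →L[ℝ] E) (endInChart J p) p)
    (x y : TangentSpace 𝓘(ℝ, E) p) : covDerivEnd g J p x y = covDerivEndInChart g J p x y := by
  have h := covDerivAlong_end_sub g (f := fun q : M ↦ q) (p := p) hJ mdifferentiableAt_id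
    (V := FiberBundle.extend E y)
    ((mdifferentiableAt_toChart_iff _ p).1 (FiberBundle.mdifferentiableAt_extend ..)) x
  rw [FiberBundle.extend_apply_self] at h
  refine h.trans ?_
  have : mfderiv 𝓘(ℝ, E) 𝓘(ℝ, E) (fun q : M ↦ q) p x = x := by
    rw [show (fun q : M ↦ q) = id from rfl, mfderiv_id]; rfl
  rw [this]

/-- `∇ₓ (J V) - J (∇ₓ V) = (∇ₓ J) V` for a vector field `V` along a map. -/
theorem covDerivAlong_end (g : BilinField E M) {J : EndField E M} {f : N → M} {p : N}
    (hJ : MDifferentiableAt 𝓘(ℝ, E) 𝓘(ℝ, E →L[ℝ] E) (endInChart J (f p)) (f p))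
    (hf : MDifferentiableAt 𝓘(ℝ, E') 𝓘(ℝ, E) f p)
    {V : (q : N) → TangentSpace 𝓘(ℝ, E) (f q)}
    (hV : MDifferentiableAt 𝓘(ℝ, E') 𝓘(ℝ, E) (fun q ↦ toChart (f p) (f q) (V q)) p)
    (x : TangentSpace 𝓘(ℝ, E') p) :
    covDerivAlong g f (fun q ↦ J (f q) (V q)) p x - J (f p) (covDerivAlong g f V p x) =
      covDerivEnd g J (f p) (mfderiv 𝓘(ℝ, E') 𝓘(ℝ, E) f p x) (V p) := by
  rw [covDerivAlong_end_sub g hJ hf hV, covDerivEnd_eq g hJ]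

theorem leviCivita_end (g : BilinField E M) {J : EndField E M} {p : M}
    (hJ : MDifferentiableAt 𝓘(ℝ, E) 𝓘(ℝ, E →L[ℝ] E) (endInChart J p) p)
    {X : (q : M) → TangentSpace 𝓘(ℝ, E) q}
    (hX : MDifferentiableAt 𝓘(ℝ, E) 𝓘(ℝ, E).tangent
      (fun q ↦ (⟨q, X q⟩ : TangentBundle 𝓘(ℝ, E) M)) p)
    (x : TangentSpace 𝓘(ℝ, E) p) :
    leviCivita g (fun q ↦ J q (X q)) p x =
      covDerivEnd g J p x (X p) + J p (leviCivita g X p x) := by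
  have h := covDerivAlong_end g (f := fun q : M ↦ q) (p := p) hJ mdifferentiableAt_id
    ((mdifferentiableAt_toChart_iff X p).1 hX) x
  have : mfderiv 𝓘(ℝ, E) 𝓘(ℝ, E) (fun q : M ↦ q) p x = x := by
    rw [show (fun q : M ↦ q) = id from rfl, mfderiv_id]; rfl
  rw [this] at h
  exact sub_eq_iff_eq_add.1 h

/-- Differentiability of `J X`. -/
theorem mdifferentiableAt_end {J : EndField E M} {p : M}
    (hJ : MDifferentiableAt 𝓘(ℝ, E) 𝓘(ℝ, E →L[ℝ] E) (endInChart J p) p)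
    {X : (q : M) → TangentSpace 𝓘(ℝ, E) q}
    (hX : MDifferentiableAt 𝓘(ℝ, E) 𝓘(ℝ, E).tangent
      (fun q ↦ (⟨q, X q⟩ : TangentBundle 𝓘(ℝ, E) M)) p) :
    MDifferentiableAt 𝓘(ℝ, E) 𝓘(ℝ, E).tangent
      (fun q ↦ (⟨q, J q (X q)⟩ : TangentBundle 𝓘(ℝ, E) M)) p := by
  rw [mdifferentiableAt_toChart_iff] at hX ⊢
  refine (hJ.clm_apply hX).congr_of_eventuallyEq ?_
  filter_upwards [eventually_mem_chart_source (E := E) p] with q hq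
  exact toChart_apply_end J hq _

theorem metricDeriv_symm {g : BilinField E M} (hs : ∀ p v w, g p v w = g p w v) {p : M}
    (hg : MDifferentiableAt 𝓘(ℝ, E) 𝓘(ℝ, E →L[ℝ] E →L[ℝ] ℝ) (metricInChart g p) p) (x : TangentSpace 𝓘(ℝ, E) p)
    (u v : E) : metricDeriv g p x u v = metricDeriv g p x v u := by
  have key : ∀ u v : E, mvfderiv 𝓘(ℝ, E) (fun q ↦ metricInChart g p q u v) p x =
      metricDeriv g p x u v := by
    intro u v
    have hu : MDifferentiableAt 𝓘(ℝ, E) 𝓘(ℝ, E →L[ℝ] ℝ) (fun q ↦ metricInChart g p q u) p :=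
      hg.clm_apply mdifferentiableAt_const
    have h1 := mvfderiv_clm_apply hu (mdifferentiableAt_const (c := v)) x
    have h2 := mvfderiv_clm_apply hg (mdifferentiableAt_const (c := u)) x
    have h0 : ∀ w : E, mvfderiv 𝓘(ℝ, E) (fun _ : M ↦ w) p x = 0 := fun w ↦ by
      rw [mvfderiv_const]; rfl
    rw [h0, map_zero, zero_add] at h1 h2
    exact h1.trans (congrArg (fun L : E →L[ℝ] ℝ ↦ L v) h2)
  rw [← key, ← key]
  congr 2
  exact funext fun q ↦ hs q _ _

theorem christoffel_symm {g : BilinField E M} (hs : ∀ p v w, g p v w = g p w v) {p : M}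
    (hg : MDifferentiableAt 𝓘(ℝ, E) 𝓘(ℝ, E →L[ℝ] E →L[ℝ] ℝ) (metricInChart g p) p) (x y : E) :
    christoffel g p x y = christoffel g p y x := by
  unfold christoffel
  congr 1
  ext z
  have := metricDeriv_symm hs hg z x y
  simp [christoffelFirst, this, add_comm]

/-- The Lie bracket in a chart. -/
theorem mlieBracket_eq_mvfderiv [FiniteDimensional ℝ E] {X Y : (q : M) → TangentSpace 𝓘(ℝ, E) q}
    {p : M}
    (hX : MDifferentiableAt 𝓘(ℝ, E) 𝓘(ℝ, E) (fun q ↦ toChart p q (X q)) p)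
    (hY : MDifferentiableAt 𝓘(ℝ, E) 𝓘(ℝ, E) (fun q ↦ toChart p q (Y q)) p) :
    VectorField.mlieBracket 𝓘(ℝ, E) X Y p =
      (mvfderiv 𝓘(ℝ, E) (fun q ↦ toChart p q (Y q)) p (X p)
        - mvfderiv 𝓘(ℝ, E) (fun q ↦ toChart p q (X q)) p (Y p) : E) := by
  let pull (X : (q : M) → TangentSpace 𝓘(ℝ, E) q) : E → E :=
    VectorField.mpullbackWithin 𝓘(ℝ, E) 𝓘(ℝ, E) (extChartAt 𝓘(ℝ, E) p).symm X
      (Set.range 𝓘(ℝ, E))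
  -- The bracket is defined by pulling back along the inverse chart; since the trivialization is the
  -- derivative of the chart, the pulled-back field is the component function.
  have hpull : ∀ X : (q : M) → TangentSpace 𝓘(ℝ, E) q,
      ∀ y ∈ (extChartAt 𝓘(ℝ, E) p).target,
      pull X y = ((fun q ↦ toChart p q (X q)) ∘ (extChartAt 𝓘(ℝ, E) p).symm) y := by
    intro X y hy
    set q := (extChartAt 𝓘(ℝ, E) p).symm y with hq
    have hqs : q ∈ (extChartAt 𝓘(ℝ, E) p).source := (extChartAt 𝓘(ℝ, E) p).map_target hy
    have hqs' : q ∈ (chartAt E p).source := by rwa [extChartAt_source] at hqs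
    have hy' : extChartAt 𝓘(ℝ, E) p q = y := (extChartAt 𝓘(ℝ, E) p).right_inv hy
    have hinv := isInvertible_mfderivWithin_extChartAt_symm (I := 𝓘(ℝ, E)) hy
    change (mfderivWithin 𝓘(ℝ, E) 𝓘(ℝ, E) (extChartAt 𝓘(ℝ, E) p).symm
      (Set.range 𝓘(ℝ, E)) y).inverse (X q) = toChart p q (X q)
    have hcomp := mfderivWithin_extChartAt_symm_comp_mfderiv_extChartAt' (I := 𝓘(ℝ, E)) hqs
    rw [hy'] at hcomp
    have ht : toChart p q (X q) = mfderiv 𝓘(ℝ, E) 𝓘(ℝ, E) (extChartAt 𝓘(ℝ, E) p) q (X q) :=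
      congrArg (fun L ↦ L (X q)) (TangentBundle.continuousLinearMapAt_trivializationAt hqs')
    rw [ht]
    refine hinv.inverse_apply_eq.2 ?_
    exact (congrArg (fun L : E →L[ℝ] E ↦ L (X q)) hcomp).symm
  have hfd : ∀ {X : (q : M) → TangentSpace 𝓘(ℝ, E) q},
      MDifferentiableAt 𝓘(ℝ, E) 𝓘(ℝ, E) (fun q ↦ toChart p q (X q)) p →
      fderivWithin ℝ (pull X) (Set.range 𝓘(ℝ, E)) (extChartAt 𝓘(ℝ, E) p p) =
        mvfderiv 𝓘(ℝ, E) (fun q ↦ toChart p q (X q)) p := by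
    intro X hX
    let D : E →L[ℝ] E := mvfderiv 𝓘(ℝ, E) (fun q ↦ toChart p q (X q)) p
    have h1 : HasFDerivWithinAt ((fun q ↦ toChart p q (X q)) ∘ (extChartAt 𝓘(ℝ, E) p).symm) D
      (Set.range 𝓘(ℝ, E)) (extChartAt 𝓘(ℝ, E) p p) := hX.hasMFDerivAt.2
    have h2 : HasFDerivWithinAt (pull X) D (Set.range 𝓘(ℝ, E)) (extChartAt 𝓘(ℝ, E) p p) := by
      refine h1.congr_of_eventuallyEq ?_ (hpull X _ (mem_extChartAt_target p))
      filter_upwards [extChartAt_target_mem_nhdsWithin (I := 𝓘(ℝ, E)) p] with y hy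
      exact hpull X y hy
    exact h2.fderivWithin 𝓘(ℝ, E).uniqueDiffWithinAt_image
  have hval : ∀ X : (q : M) → TangentSpace 𝓘(ℝ, E) q, pull X (extChartAt 𝓘(ℝ, E) p p) = X p := by
    intro X
    rw [hpull X _ (mem_extChartAt_target p), Function.comp_apply, extChartAt_to_inv, toChart_self]
  have hinv : ∀ v : E, (mfderiv 𝓘(ℝ, E) 𝓘(ℝ, E) (extChartAt 𝓘(ℝ, E) p) p).inverse v = v := by
    intro v
    refine (isInvertible_mfderiv_extChartAt (mem_extChartAt_source p)).inverse_apply_eq.2 ?_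
    have ht : toChart p p v = mfderiv 𝓘(ℝ, E) 𝓘(ℝ, E) (extChartAt 𝓘(ℝ, E) p) p v :=
      congrArg (fun L : E →L[ℝ] E ↦ L v)
        (TangentBundle.continuousLinearMapAt_trivializationAt (mem_chart_source E p))
    rw [← ht]
    exact (toChart_self p v).symm
  rw [← VectorField.mlieBracketWithin_univ, VectorField.mlieBracketWithin_apply, hinv,
    Set.preimage_univ, Set.univ_inter]
  change fderivWithin ℝ (pull Y) (Set.range 𝓘(ℝ, E)) (extChartAt 𝓘(ℝ, E) p p)
      (pull X (extChartAt 𝓘(ℝ, E) p p)) -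
    fderivWithin ℝ (pull X) (Set.range 𝓘(ℝ, E)) (extChartAt 𝓘(ℝ, E) p p)
      (pull Y (extChartAt 𝓘(ℝ, E) p p)) = _
  rw [hfd hX, hfd hY, hval, hval]
  rfl

/-- The Levi-Civita connection is torsion-free. -/
theorem leviCivita_sub_leviCivita [FiniteDimensional ℝ E] {g : BilinField E M}
    (hs : ∀ p v w, g p v w = g p w v) {p : M}
    (hg : MDifferentiableAt 𝓘(ℝ, E) 𝓘(ℝ, E →L[ℝ] E →L[ℝ] ℝ) (metricInChart g p) p)
    {X Y : (q : M) → TangentSpace 𝓘(ℝ, E) q}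
    (hX : MDifferentiableAt 𝓘(ℝ, E) 𝓘(ℝ, E).tangent
      (fun q ↦ (⟨q, X q⟩ : TangentBundle 𝓘(ℝ, E) M)) p)
    (hY : MDifferentiableAt 𝓘(ℝ, E) 𝓘(ℝ, E).tangent
      (fun q ↦ (⟨q, Y q⟩ : TangentBundle 𝓘(ℝ, E) M)) p) :
    VectorField.mlieBracket 𝓘(ℝ, E) X Y p = leviCivita g Y p (X p) - leviCivita g X p (Y p) := by
  rw [mlieBracket_eq_mvfderiv ((mdifferentiableAt_toChart_iff X p).1 hX)
    ((mdifferentiableAt_toChart_iff Y p).1 hY), leviCivita, leviCivita, covDerivAlong_apply,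
    covDerivAlong_apply]
  have : ∀ x, mfderiv 𝓘(ℝ, E) 𝓘(ℝ, E) (fun q : M ↦ q) p x = x := fun x ↦ by
    rw [show (fun q : M ↦ q) = id from rfl, mfderiv_id]; rfl
  rw [this, this, christoffel_symm hs hg (Y p) (X p)]
  exact (add_sub_add_right_eq_sub _ _ (christoffel g p (X p) (Y p))).symm

/-- The Nijenhuis tensor in terms of the covariant derivative of the complex structure. -/
theorem nijenhuis_eq_covDerivEnd [FiniteDimensional ℝ E] {g : BilinField E M}
    (hs : ∀ p v w, g p v w = g p w v) {J : EndField E M} (hJJ : ∀ p x, J p (J p x) = -x) {p : M}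
    (hg : MDifferentiableAt 𝓘(ℝ, E) 𝓘(ℝ, E →L[ℝ] E →L[ℝ] ℝ) (metricInChart g p) p)
    (hJ : MDifferentiableAt 𝓘(ℝ, E) 𝓘(ℝ, E →L[ℝ] E) (endInChart J p) p)
    {X Y : (q : M) → TangentSpace 𝓘(ℝ, E) q}
    (hX : MDifferentiableAt 𝓘(ℝ, E) 𝓘(ℝ, E).tangent
      (fun q ↦ (⟨q, X q⟩ : TangentBundle 𝓘(ℝ, E) M)) p)
    (hY : MDifferentiableAt 𝓘(ℝ, E) 𝓘(ℝ, E).tangent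
      (fun q ↦ (⟨q, Y q⟩ : TangentBundle 𝓘(ℝ, E) M)) p) :
    nijenhuis J X Y p = covDerivEnd g J p (J p (X p)) (Y p) - covDerivEnd g J p (J p (Y p)) (X p)
      + J p (covDerivEnd g J p (Y p) (X p)) - J p (covDerivEnd g J p (X p) (Y p)) := by
  have hJX := mdifferentiableAt_end hJ hX
  have hJY := mdifferentiableAt_end hJ hY
  rw [nijenhuis, leviCivita_sub_leviCivita hs hg hJX hJY, leviCivita_sub_leviCivita hs hg hJX hY,
    leviCivita_sub_leviCivita hs hg hX hJY, leviCivita_sub_leviCivita hs hg hX hY]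
  -- After expanding each `∇(J X)` by the product rule, the derivatives of `X` and `Y` cancel in
  -- pairs because `J² = -1`.
  simp only [leviCivita_end g hJ hX, leviCivita_end g hJ hY, map_sub, map_add, hJJ]
  abel

end CovariantDerivative

/-! ### Smoothness of the induced metric and endomorphisms -/

section Induced

theorem inducedMetric_apply {E : Type*} [NormedAddCommGroup E] [NormedSpace ℝ E]
    {M : Type*} [TopologicalSpace M] [ChartedSpace E M]
    {E' : Type*} [NormedAddCommGroup E'] [NormedSpace ℝ E']
    {M' : Type*} [TopologicalSpace M'] [ChartedSpace E' M'] (ι : M → M') 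
    (g : BilinField E' M') (p : M) (u v : TangentSpace 𝓘(ℝ, E) p) :
    inducedMetric ι g p u v = g (ι p) (mfderiv 𝓘(ℝ, E) 𝓘(ℝ, E') ι p u)
      (mfderiv 𝓘(ℝ, E) 𝓘(ℝ, E') ι p v) := rfl

variable {E : Type*} [NormedAddCommGroup E] [NormedSpace ℝ E]
  {M : Type*} [TopologicalSpace M] [ChartedSpace E M] [IsManifold 𝓘(ℝ, E) ∞ M]
  {E' : Type*} [NormedAddCommGroup E'] [NormedSpace ℝ E']
  {M' : Type*} [TopologicalSpace M'] [ChartedSpace E' M'] [IsManifold 𝓘(ℝ, E') ∞ M']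

/-- The matrix of the differential of `ι` in the charts around `p` and `ι p`. -/
def mfderivInChart (ι : M → M') (p q : M) : E →L[ℝ] E' :=
  (toChart (ι p) (ι q)).comp ((mfderiv 𝓘(ℝ, E) 𝓘(ℝ, E') ι q).comp (ofChart p q))

theorem contMDiffAt_mfderivInChart {ι : M → M'} (hι : ContMDiff 𝓘(ℝ, E) 𝓘(ℝ, E') ∞ ι) (p : M) :
    ContMDiffAt 𝓘(ℝ, E) 𝓘(ℝ, E →L[ℝ] E') ∞ (mfderivInChart (E := E) (E' := E') ι p) p :=
  (hι p).mfderiv_const (m := ∞) (by simp)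

theorem mfderivInChart_toChart (ι : M → M') {p q : M} (hq : q ∈ (chartAt E p).source)
    (v : TangentSpace 𝓘(ℝ, E) q) :
    mfderivInChart ι p q (toChart p q v) =
      toChart (ι p) (ι q) (mfderiv 𝓘(ℝ, E) 𝓘(ℝ, E') ι q v) := by
  simp only [mfderivInChart, ContinuousLinearMap.comp_apply, ofChart_toChart hq]

theorem ofChart_mfderivInChart (ι : M → M') {p q : M} (hq : ι q ∈ (chartAt E' (ι p)).source)
    (v : E) :
    ofChart (ι p) (ι q) (mfderivInChart ι p q v) =
      mfderiv 𝓘(ℝ, E) 𝓘(ℝ, E') ι q (ofChart p q v) := by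
  simp only [mfderivInChart, ContinuousLinearMap.comp_apply, ofChart_toChart hq]

theorem mdifferentiableAt_toChart_mfderiv {ι : M → M'}
    (hι : ContMDiff 𝓘(ℝ, E) 𝓘(ℝ, E') ∞ ι) {X : (q : M) → TangentSpace 𝓘(ℝ, E) q} {p : M}
    (hX : MDifferentiableAt 𝓘(ℝ, E) 𝓘(ℝ, E).tangent
      (fun q ↦ (⟨q, X q⟩ : TangentBundle 𝓘(ℝ, E) M)) p) :
    MDifferentiableAt 𝓘(ℝ, E) 𝓘(ℝ, E')
      (fun q ↦ toChart (ι p) (ι q) (mfderiv 𝓘(ℝ, E) 𝓘(ℝ, E') ι q (X q))) p := by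
  have h := ((contMDiffAt_mfderivInChart hι p).mdifferentiableAt (by simp)).clm_apply
    ((mdifferentiableAt_toChart_iff X p).1 hX)
  refine h.congr_of_eventuallyEq ?_
  filter_upwards [eventually_mem_chart_source (E := E) p] with q hq
  exact (mfderivInChart_toChart ι hq _).symm

omit [IsManifold 𝓘(ℝ, E) ∞ M] in
/-- Pulling back a smooth family of bilinear forms by smooth families of linear maps. -/
theorem ContMDiffAt.bilinearComp {F G : Type*} [NormedAddCommGroup F] [NormedSpace ℝ F]
    [NormedAddCommGroup G] [NormedSpace ℝ G] {p : M}
    {B : M → F →L[ℝ] F →L[ℝ] ℝ} {A C : M → G →L[ℝ] F}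
    (hB : ContMDiffAt 𝓘(ℝ, E) 𝓘(ℝ, F →L[ℝ] F →L[ℝ] ℝ) ∞ B p)
    (hA : ContMDiffAt 𝓘(ℝ, E) 𝓘(ℝ, G →L[ℝ] F) ∞ A p)
    (hC : ContMDiffAt 𝓘(ℝ, E) 𝓘(ℝ, G →L[ℝ] F) ∞ C p) :
    ContMDiffAt 𝓘(ℝ, E) 𝓘(ℝ, G →L[ℝ] G →L[ℝ] ℝ) ∞ (fun q ↦ (B q).bilinearComp (A q) (C q)) p := by
  have hC' : ContMDiffAt 𝓘(ℝ, E) 𝓘(ℝ, (F →L[ℝ] ℝ) →L[ℝ] (G →L[ℝ] ℝ)) ∞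
      (fun q ↦ (C q).precomp ℝ) p := hC.clm_precomp
  have h := hC'.clm_comp (hB.clm_comp hA)
  refine h.congr_of_eventuallyEq (.of_forall fun q ↦ ?_)
  ext u v
  rfl

theorem metricInChart_inducedMetric (ι : M → M') (g : BilinField E' M') {p q : M}
    (hq : ι q ∈ (chartAt E' (ι p)).source) :
    metricInChart (E := E) (inducedMetric ι g) p q =
      (metricInChart g (ι p) (ι q)).bilinearComp (mfderivInChart ι p q)
        (mfderivInChart ι p q) := by
  ext u v
  rw [metricInChart_apply, inducedMetric_apply, ContinuousLinearMap.bilinearComp_apply,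
    metricInChart_apply, ofChart_mfderivInChart ι hq, ofChart_mfderivInChart ι hq]

theorem contMDiffAt_metricInChart_inducedMetric {ι : M → M'}
    (hι : ContMDiff 𝓘(ℝ, E) 𝓘(ℝ, E') ∞ ι) {g : BilinField E' M'}
    (hg : ∀ p, ContMDiffAt 𝓘(ℝ, E') 𝓘(ℝ, E' →L[ℝ] E' →L[ℝ] ℝ) ∞ (metricInChart g p) p) (p : M) :
    ContMDiffAt 𝓘(ℝ, E) 𝓘(ℝ, E →L[ℝ] E →L[ℝ] ℝ) ∞
      (metricInChart (E := E) (inducedMetric ι g) p) p := by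
  have hA := contMDiffAt_mfderivInChart hι p
  refine (((hg (ι p)).comp p (hι p)).bilinearComp hA hA).congr_of_eventuallyEq ?_
  filter_upwards [(hι p).continuousAt.eventually (eventually_mem_chart_source (E := E') (ι p))]
    with q hq
  exact metricInChart_inducedMetric ι g hq

/-- Nondegeneracy gives injectivity, and `E` and its dual have equal finite dimension. Invertibility
is what makes `inverse` smooth at the metric. -/
theorem isInvertible_metricInChart [FiniteDimensional ℝ E] {g : BilinField E M} {p q : M}
    (hn : ∀ v, (∀ w, g q v w = 0) → v = 0) (hq : q ∈ (chartAt E p).source) :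
    (metricInChart g p q).IsInvertible := by
  have hinj : Function.Injective (metricInChart g p q).toLinearMap := by
    rw [← LinearMap.ker_eq_bot, LinearMap.ker_eq_bot']
    intro u hu
    have h0 : ofChart p q u = 0 := by
      refine hn _ fun w ↦ ?_
      rw [← metricInChart_toChart g hq, toChart_ofChart hq]
      exact ContinuousLinearMap.ext_iff.1 hu _
    rw [← toChart_ofChart hq u, h0, map_zero]
  have hdim : Module.finrank ℝ E = Module.finrank ℝ (E →L[ℝ] ℝ) := by
    rw [← (LinearMap.toContinuousLinearMap (𝕜 := ℝ) (E := E) (F' := ℝ)).finrank_eq]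
    exact Subspace.dual_finrank_eq.symm
  let e := (LinearEquiv.ofInjectiveOfFinrankEq _ hinj hdim).toContinuousLinearEquiv
  exact ⟨e, by ext; rfl⟩

/-- The left inverse in `inducedEnd` is chosen point by point, so smoothness cannot come from it.
Nondegeneracy supplies a smooth formula instead: the induced `J` is the inverse of the induced
metric applied to the form `g(J dι u, dι v)`. -/
theorem contMDiffAt_endInChart_inducedEnd [FiniteDimensional ℝ E] {m n : ℕ} {ι : M → M'}
    {J : Fin 3 → EndField E' M'} {g : BilinField E' M'}
    (hι : IsHolomorphicSubmanifold (E := E) m n ι J g)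
    (hg : ∀ p, ContMDiffAt 𝓘(ℝ, E') 𝓘(ℝ, E' →L[ℝ] E' →L[ℝ] ℝ) ∞ (metricInChart g p) p)
    (α : Fin 3) (hJ : ∀ p, ContMDiffAt 𝓘(ℝ, E') 𝓘(ℝ, E' →L[ℝ] E') ∞ (endInChart (J α) p) p)
    (p : M) :
    ContMDiffAt 𝓘(ℝ, E) 𝓘(ℝ, E →L[ℝ] E) ∞ (endInChart (E := E) (inducedEnd ι (J α)) p) p := by
  have hA := contMDiffAt_mfderivInChart hι.smooth p
  have hG := contMDiffAt_metricInChart_inducedMetric hι.smooth hg p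
  have hGi := (isInvertible_metricInChart (hι.nondegenerate p)
    (mem_chart_source E p)).contDiffAt_map_inverse (n := ∞)
  have hGinv := hGi.contMDiffAt.comp p hG
  have hL := ((hg (ι p)).comp p (hι.smooth p)).bilinearComp
    (((hJ (ι p)).comp p (hι.smooth p)).clm_comp hA) hA
  refine (hGinv.clm_comp hL).congr_of_eventuallyEq ?_
  filter_upwards [eventually_mem_chart_source (E := E) p, (hι.smooth p).continuousAt.eventually
    (eventually_mem_chart_source (E := E') (ι p))] with q hq hq'
  ext u
  have hinv := isInvertible_metricInChart (hι.nondegenerate q) hq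
  refine (hinv.inverse_apply_eq.2 ?_).symm
  refine ContinuousLinearMap.ext fun v ↦ ?_
  change metricInChart g (ι p) (ι q) (endInChart (J α) (ι p) (ι q) (mfderivInChart ι p q u))
    (mfderivInChart ι p q v) = metricInChart (E := E) (inducedMetric ι g) p q
      (endInChart (E := E) (inducedEnd ι (J α)) p q u) v
  rw [metricInChart_apply, metricInChart_apply, inducedMetric_apply,
    ofChart_mfderivInChart ι hq', endInChart, endInChart]
  simp only [ContinuousLinearMap.comp_apply, ofChart_toChart hq, ofChart_toChart hq',
    ofChart_mfderivInChart ι hq', mfderiv_inducedEnd hι]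

end Induced

/-! ### Fundamental tensors determined by a linear form, and their restriction -/

section FundamentalForm

variable {E : Type*} [NormedAddCommGroup E] [NormedSpace ℝ E] [FiniteDimensional ℝ E]
  {M : Type*} [TopologicalSpace M] [ChartedSpace E M] [IsManifold 𝓘(ℝ, E) ∞ M]
  {E' : Type*} [NormedAddCommGroup E'] [NormedSpace ℝ E']
  {M' : Type*} [TopologicalSpace M'] [ChartedSpace E' M'] [IsManifold 𝓘(ℝ, E') ∞ M']

/-- The Lee form as a linear map. -/
def leeLinear (g : BilinField E M) (J : EndField E M) (p : M) :
    TangentSpace 𝓘(ℝ, E) p →ₗ[ℝ] ℝ where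
  toFun := leeForm g J p
  map_add' x y := by
    simp only [leeForm, fundamentalTensor, map_add, mul_add, Finset.sum_add_distrib]
  map_smul' c x := by
    simp only [leeForm, fundamentalTensor, map_smul, smul_eq_mul, Finset.mul_sum,
      RingHom.id_apply, mul_left_comm]

theorem leeLinear_apply (g : BilinField E M) (J : EndField E M) (p : M)
    (z : TangentSpace 𝓘(ℝ, E) p) : leeLinear g J p z = leeForm g J p z := rfl

omit [FiniteDimensional ℝ E] [IsManifold 𝓘(ℝ, E) ∞ M] in
/-- A field of bilinear forms as a bilinear form at a point. -/
def bilinFormAt (g : BilinField E M) (p : M) :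
    LinearMap.BilinForm ℝ (TangentSpace 𝓘(ℝ, E) p) :=
  LinearMap.mk₂ ℝ (fun x y ↦ g p x y) (by simp) (by simp) (by simp) (by simp)

/-- The fundamental tensor of `J` is the tensor built from the Lee form, with the sign `δ = -1` for
Hermitian and `δ = 1` for Norden metrics. -/
def IsConformalType (δ c : ℝ) (g : BilinField E M) (J : EndField E M)
    (θ : (p : M) → TangentSpace 𝓘(ℝ, E) p →ₗ[ℝ] ℝ) (p : M) : Prop :=
  ∀ x y z, fundamentalTensor g J p x y z = c * (g p x y * θ p z + δ * (g p x z * θ p y)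
    + δ * (g p x (J p y) * θ p (J p z)) + g p x (J p z) * θ p (J p y))

/-- Here `θ` is any field of linear forms, so that the result applies to the pullback of the ambient
Lee form; the factor comes from `sum_gram_inv_mul_fundamental`. -/
theorem leeForm_eq_of_isConformalType {g : BilinField E M} {J : EndField E M} {p : M}
    (hs : ∀ x y, g p x y = g p y x) (hn : ∀ v, (∀ w, g p v w = 0) → v = 0)
    (hJJ : ∀ x, J p (J p x) = -x) (htr : LinearMap.trace ℝ _ (J p).toLinearMap = 0) {δ c : ℝ}
    {θ : (p : M) → TangentSpace 𝓘(ℝ, E) p →ₗ[ℝ] ℝ} (h : IsConformalType δ c g J θ p)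
    (z : TangentSpace 𝓘(ℝ, E) p) :
    leeForm g J p z = c * (Module.finrank ℝ E + δ - 1) * θ p z := by
  have : FiniteDimensional ℝ (TangentSpace 𝓘(ℝ, E) p) := ‹FiniteDimensional ℝ E›
  let b : Module.Basis (Fin (Module.finrank ℝ E)) ℝ (TangentSpace 𝓘(ℝ, E) p) := Module.finBasis ℝ E
  have key := sum_gram_inv_mul_fundamental b (B := bilinFormAt g p) hs hn
    (J := (J p).toLinearMap) hJJ htr (θ p) δ c z
  rw [← key]
  refine Finset.sum_congr rfl fun i _ ↦ Finset.sum_congr rfl fun j _ ↦ ?_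
  exact congrArg (HMul.hMul _) (h (b i) (b j) z)

/-- The Nijenhuis tensor vanishes if the fundamental tensor is expressed through a linear form. -/
theorem nijenhuis_eq_zero_of_isConformalType {g : BilinField E M} {J : EndField E M} {p : M}
    (hs : ∀ p x y, g p x y = g p y x) (hn : ∀ v, (∀ w, g p v w = 0) → v = 0)
    (hJJ : ∀ p x, J p (J p x) = -x) {δ c : ℝ} (hδ : δ = 1 ∨ δ = -1)
    (hadj : ∀ x y, g p (J p x) y = δ * g p x (J p y))
    {θ : (p : M) → TangentSpace 𝓘(ℝ, E) p →ₗ[ℝ] ℝ} (h : IsConformalType δ c g J θ p)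
    (hg : MDifferentiableAt 𝓘(ℝ, E) 𝓘(ℝ, E →L[ℝ] E →L[ℝ] ℝ) (metricInChart g p) p)
    (hJ : MDifferentiableAt 𝓘(ℝ, E) 𝓘(ℝ, E →L[ℝ] E) (endInChart J p) p)
    {X Y : (q : M) → TangentSpace 𝓘(ℝ, E) q}
    (hX : MDifferentiableAt 𝓘(ℝ, E) 𝓘(ℝ, E).tangent
      (fun q ↦ (⟨q, X q⟩ : TangentBundle 𝓘(ℝ, E) M)) p)
    (hY : MDifferentiableAt 𝓘(ℝ, E) 𝓘(ℝ, E).tangent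
      (fun q ↦ (⟨q, Y q⟩ : TangentBundle 𝓘(ℝ, E) M)) p) :
    nijenhuis J X Y p = 0 := by
  refine hn _ fun Z ↦ ?_
  rw [nijenhuis_eq_covDerivEnd hs hJJ hg hJ hX hY]
  set x := X p
  set y := Y p
  have e1 : g p (J p (covDerivEnd g J p y x)) Z = δ * fundamentalTensor g J p y x (J p Z) :=
    hadj _ _
  have e2 : g p (J p (covDerivEnd g J p x y)) Z = δ * fundamentalTensor g J p x y (J p Z) :=
    hadj _ _
  have e3 : g p (covDerivEnd g J p (J p x) y) Z = fundamentalTensor g J p (J p x) y Z := rfl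
  have e4 : g p (covDerivEnd g J p (J p y) x) Z = fundamentalTensor g J p (J p y) x Z := rfl
  rw [map_sub, map_add, map_sub]
  change g p _ Z - g p _ Z + g p _ Z - g p _ Z = 0
  rw [e1, e2, e3, e4, h, h, h, h]
  -- With every metric term brought to a common shape, only a polynomial identity for `δ = ±1` is
  -- left.
  have hxy : g p x (J p y) = δ * g p y (J p x) := by rw [← hadj y x, hs]
  simp only [hadj, hJJ, map_neg, hs p y x, hxy]
  rcases hδ with rfl | rfl <;> ring

/-- The covariant derivative of `J` restricts to totally geodesic invariant submanifolds. -/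
theorem mfderiv_covDerivEnd {m n : ℕ} {ι : M → M'} {J : Fin 3 → EndField E' M'}
    {g : BilinField E' M'} (hι : IsHolomorphicSubmanifold (E := E) m n ι J g)
    (hgeo : IsTotallyGeodesic E ι g) {α : Fin 3} {p : M}
    (hJ : MDifferentiableAt 𝓘(ℝ, E') 𝓘(ℝ, E' →L[ℝ] E') (endInChart (J α) (ι p)) (ι p))
    (hJi : MDifferentiableAt 𝓘(ℝ, E) 𝓘(ℝ, E →L[ℝ] E)
      (endInChart (E := E) (inducedEnd ι (J α)) p) p) (x y : TangentSpace 𝓘(ℝ, E) p) :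
    mfderiv 𝓘(ℝ, E) 𝓘(ℝ, E') ι p (covDerivEnd (inducedMetric ι g) (inducedEnd ι (J α)) p x y) =
      covDerivEnd g (J α) (ι p) (mfderiv 𝓘(ℝ, E) 𝓘(ℝ, E') ι p x)
        (mfderiv 𝓘(ℝ, E) 𝓘(ℝ, E') ι p y) := by
  have hY : MDifferentiableAt 𝓘(ℝ, E) 𝓘(ℝ, E).tangent
      (fun q ↦ (⟨q, FiberBundle.extend E y q⟩ : TangentBundle 𝓘(ℝ, E) M)) p :=
    FiberBundle.mdifferentiableAt_extend ..
  -- Total geodesy is used for both `Y` and `J Y`, so that `dι` passes through both derivatives in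
  -- `(∇ₓ J) y = ∇ₓ (J Y) - J (∇ₓ Y)`.
  have h1 := sub_eq_zero.1 (hgeo _ p x hY)
  have h2 := sub_eq_zero.1 (hgeo _ p x (mdifferentiableAt_end hJi hY))
  have h3 : (fun q ↦ mfderiv 𝓘(ℝ, E) 𝓘(ℝ, E') ι q
      (inducedEnd ι (J α) q (FiberBundle.extend E y q))) =
      fun q ↦ J α (ι q) (mfderiv 𝓘(ℝ, E) 𝓘(ℝ, E') ι q (FiberBundle.extend E y q)) :=
    funext fun q ↦ mfderiv_inducedEnd hι α q _
  rw [h3] at h2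
  have h4 := covDerivAlong_end g hJ (hι.smooth.mdifferentiableAt (by simp))
    (mdifferentiableAt_toChart_mfderiv hι.smooth hY) x
  rw [FiberBundle.extend_apply_self] at h4
  rw [covDerivEnd, map_sub, mfderiv_inducedEnd hι, ← h1, ← h2, h4]

theorem fundamentalTensor_inducedMetric {m n : ℕ} {ι : M → M'} {J : Fin 3 → EndField E' M'}
    {g : BilinField E' M'} (hι : IsHolomorphicSubmanifold (E := E) m n ι J g)
    (hgeo : IsTotallyGeodesic E ι g) {α : Fin 3} {p : M}
    (hJ : MDifferentiableAt 𝓘(ℝ, E') 𝓘(ℝ, E' →L[ℝ] E') (endInChart (J α) (ι p)) (ι p))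
    (hJi : MDifferentiableAt 𝓘(ℝ, E) 𝓘(ℝ, E →L[ℝ] E)
      (endInChart (E := E) (inducedEnd ι (J α)) p) p) (x y z : TangentSpace 𝓘(ℝ, E) p) :
    fundamentalTensor (inducedMetric ι g) (inducedEnd ι (J α)) p x y z =
      fundamentalTensor g (J α) (ι p) (mfderiv 𝓘(ℝ, E) 𝓘(ℝ, E') ι p x)
        (mfderiv 𝓘(ℝ, E) 𝓘(ℝ, E') ι p y) (mfderiv 𝓘(ℝ, E) 𝓘(ℝ, E') ι p z) := by
  rw [fundamentalTensor, inducedMetric_apply, mfderiv_covDerivEnd hι hgeo hJ hJi,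
    fundamentalTensor]

/-- The linear form `θ` vanishes on the normal vectors of a totally geodesic holomorphic
submanifold. -/
theorem eq_zero_of_normal {m n : ℕ} {ι : M → M'} {J : Fin 3 → EndField E' M'}
    {g : BilinField E' M'} (hι : IsHolomorphicSubmanifold (E := E) m n ι J g)
    (hgeo : IsTotallyGeodesic E ι g) {α : Fin 3} {p : M}
    (hJ : MDifferentiableAt 𝓘(ℝ, E') 𝓘(ℝ, E' →L[ℝ] E') (endInChart (J α) (ι p)) (ι p))
    (hJi : MDifferentiableAt 𝓘(ℝ, E) 𝓘(ℝ, E →L[ℝ] E)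
      (endInChart (E := E) (inducedEnd ι (J α)) p) p)
    (hs : ∀ p x y, g p x y = g p y x) (hJJ : ∀ x, J α (ι p) (J α (ι p) x) = -x) {δ c : ℝ}
    (hc : c ≠ 0) (hδ : δ ≠ 0) (hadj : ∀ x y, g (ι p) (J α (ι p) x) y = δ * g (ι p) x (J α (ι p) y))
    {θ : (p : M') → TangentSpace 𝓘(ℝ, E') p →ₗ[ℝ] ℝ}
    (h : IsConformalType δ c g (J α) θ (ι p)) {ξ : TangentSpace 𝓘(ℝ, E') (ι p)}
    (hξ : ∀ y, g (ι p) ξ (mfderiv 𝓘(ℝ, E) 𝓘(ℝ, E') ι p y) = 0) : θ (ι p) ξ = 0 := by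
  set dι := mfderiv 𝓘(ℝ, E) 𝓘(ℝ, E') ι p with hdι
  have hξ' : ∀ y, g (ι p) (dι y) ξ = 0 := fun y ↦ (hs _ _ _).trans (hξ y)
  -- The normal space is `J`-invariant, since the tangent space is and `J` is its own adjoint up to
  -- sign.
  have hJξ : ∀ y, g (ι p) (dι y) (J α (ι p) ξ) = 0 := by
    intro y
    have h1 := hadj (dι y) ξ
    rw [hdι, ← mfderiv_inducedEnd hι, hξ'] at h1
    exact (mul_eq_zero.1 h1.symm).resolve_left hδ
  have hind : ∀ x, inducedEnd (E := E) ι (J α) p (inducedEnd ι (J α) p x) = -x := by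
    intro x
    apply hι.immersion p
    rw [mfderiv_inducedEnd hι, mfderiv_inducedEnd hι, hJJ, map_neg]
  obtain ⟨y, hy⟩ : ∃ y : TangentSpace 𝓘(ℝ, E) p, y ≠ 0 := by
    have hpos : 0 < Module.finrank ℝ E := hι.dim ▸ Nat.mul_pos four_pos hι.pos
    have : Nontrivial E := Module.nontrivial_of_finrank_pos hpos
    exact exists_ne (0 : E)
  have hzero : θ (ι p) ξ • y +
      (δ * θ (ι p) (J α (ι p) ξ)) • inducedEnd (E := E) ι (J α) p y = 0 := by
    refine hι.nondegenerate p _ fun x ↦ ?_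
    have h1 := h (dι x) (dι y) ξ
    -- The derivative of `J` along tangent vectors is tangent, so the left side vanishes; on the
    -- right the two terms pairing `x` with `ξ` or `J ξ` drop out.
    rw [fundamentalTensor, ← mfderiv_covDerivEnd hι hgeo hJ hJi, hξ', hξ', hJξ] at h1
    have h2 := (mul_eq_zero.1 h1.symm).resolve_left hc
    rw [inducedMetric_apply, hs, map_add, map_smul, map_smul, mfderiv_inducedEnd hι, map_add,
      map_smul, map_smul]
    simp only [smul_eq_mul]
    linear_combination h2
  refine eq_zero_of_smul_eq_smul_complexStructure (J := (inducedEnd (E := E) ι (J α) p).toLinearMap)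
    hind hy (b := -(δ * θ (ι p) (J α (ι p) ξ))) ?_
  rw [neg_smul]
  exact eq_neg_of_add_eq_zero_left hzero

end FundamentalForm

/-! ### The Hermitian and Norden conditions in a single form -/

section WManifold

variable {E : Type*} [NormedAddCommGroup E] [NormedSpace ℝ E] [FiniteDimensional ℝ E]
  {M : Type*} [TopologicalSpace M] [ChartedSpace E M] [IsManifold 𝓘(ℝ, E) ∞ M]
  {E' : Type*} [NormedAddCommGroup E'] [NormedSpace ℝ E']
  {M' : Type*} [TopologicalSpace M'] [ChartedSpace E' M'] [IsManifold 𝓘(ℝ, E') ∞ M']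

/-- The sign that distinguishes the Hermitian structure `J₁` from the Norden structures. -/
def hnSign (α : Fin 3) : ℝ := if α = 0 then -1 else 1

theorem hnSign_eq (α : Fin 3) : hnSign α = 1 ∨ hnSign α = -1 := by
  unfold hnSign
  split_ifs <;> simp

/-- The constant in the defining condition of a `𝒲`-manifold of dimension `4 n`. -/
def hnConst (n : ℕ) (α : Fin 3) : ℝ := 1 / (4 * n + hnSign α - 1)

theorem four_mul_add_hnSign_sub_one_pos {n : ℕ} (hn : 0 < n) (α : Fin 3) :
    (0 : ℝ) < 4 * n + hnSign α - 1 := by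
  have : (1 : ℝ) ≤ n := by exact_mod_cast hn
  rcases hnSign_eq α with h | h <;> rw [h] <;> linarith

theorem hnConst_zero (n : ℕ) : hnConst n 0 = 1 / (2 * (2 * (n : ℝ) - 1)) := by
  rw [hnConst, hnSign, if_pos rfl]
  ring_nf

theorem hnConst_of_ne (n : ℕ) {α : Fin 3} (h : α ≠ 0) : hnConst n α = 1 / (4 * (n : ℝ)) := by
  rw [hnConst, hnSign, if_neg h]
  ring_nf

omit [FiniteDimensional ℝ E] in
-- Replacing `y` by `J y` in the compatibility of `g` with `J` and using `J² = -1` makes `J₁`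
-- skew-adjoint and `J₂`, `J₃` self-adjoint.
theorem IsAlmostHypercomplexHN.adjoint {n : ℕ} {J : Fin 3 → EndField E M} {g : BilinField E M}
    (h : IsAlmostHypercomplexHN n J g) (α : Fin 3) (p : M) (x y : TangentSpace 𝓘(ℝ, E) p) :
    g p (J α p x) y = hnSign α * g p x (J α p y) := by
  have hy : g p (J α p x) (J α p (J α p y)) = -g p (J α p x) y := by rw [h.sq, map_neg]
  fin_cases α
  · have := h.hermitian p x (J 0 p y)
    simp only [hnSign, Fin.zero_eta, if_true] at hy ⊢
    linarith
  · have := h.norden_two p x (J 1 p y)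
    simp only [hnSign, Fin.mk_one, one_ne_zero, if_false] at hy ⊢
    linarith
  · have := h.norden_three p x (J 2 p y)
    simp only [hnSign, Fin.reduceFinMk, Fin.reduceEq, if_false] at hy ⊢
    linarith

theorem IsWManifold.isConformalType {n : ℕ} {J : Fin 3 → EndField E M} {g : BilinField E M}
    (h : IsWManifold n J g) (α : Fin 3) (p : M) :
    IsConformalType (hnSign α) (hnConst n α) g (J α) (leeLinear g (J α)) p := by
  intro x y z
  by_cases hα : α = 0
  · subst hα
    rw [h.fundamental_one, hnConst_zero, hnSign, if_pos rfl]
    simp only [leeLinear_apply]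
    ring
  · rw [h.fundamental_norden α hα, hnConst_of_ne n hα, hnSign, if_neg hα]
    simp only [leeLinear_apply]
    ring

/-- An invariant submanifold with nondegenerate induced metric is an almost hypercomplex manifold
with Hermitian and Norden metrics. -/
theorem IsHolomorphicSubmanifold.isAlmostHypercomplexHN {m n : ℕ} {J : Fin 3 → EndField E' M'}
    {g : BilinField E' M'} {ι : M → M'} (hι : IsHolomorphicSubmanifold (E := E) m n ι J g)
    (h : IsAlmostHypercomplexHN n J g) :
    IsAlmostHypercomplexHN (E := E) m (fun α ↦ inducedEnd ι (J α)) (inducedMetric ι g) where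
  dim := hι.dim
  smooth α p := (contMDiffAt_endField_iff _ p).2 <| contMDiffAt_endInChart_inducedEnd hι
    (fun q ↦ (contMDiffAt_bilinField_iff g q).1 (h.metric.smooth q)) α
    (fun q ↦ (contMDiffAt_endField_iff (J α) q).1 (h.smooth α q)) p
  sq α p x := hι.immersion p <| by
    rw [mfderiv_inducedEnd hι, mfderiv_inducedEnd hι, h.sq, map_neg]
  comp α p x := hι.immersion p <| by
    rw [mfderiv_inducedEnd hι, mfderiv_inducedEnd hι, mfderiv_inducedEnd hι, h.comp]
  comp_rev α p x := hι.immersion p <| by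
    rw [mfderiv_inducedEnd hι, mfderiv_inducedEnd hι, map_neg, mfderiv_inducedEnd hι, h.comp_rev]
  metric :=
    { smooth := fun p ↦ (contMDiffAt_bilinField_iff _ p).2 <|
        contMDiffAt_metricInChart_inducedMetric hι.smooth
          (fun q ↦ (contMDiffAt_bilinField_iff g q).1 (h.metric.smooth q)) p
      symm := fun p x y ↦ h.metric.symm _ _ _
      nondegenerate := hι.nondegenerate }
  hermitian p x y := by
    rw [inducedMetric_apply, mfderiv_inducedEnd hι, mfderiv_inducedEnd hι, h.hermitian]; rfl
  norden_two p x y := by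
    rw [inducedMetric_apply, mfderiv_inducedEnd hι, mfderiv_inducedEnd hι, h.norden_two]; rfl
  norden_three p x y := by
    rw [inducedMetric_apply, mfderiv_inducedEnd hι, mfderiv_inducedEnd hι, h.norden_three]; rfl

end WManifold

end

/-! ### Totally geodesic holomorphic submanifolds of `𝒲`-manifolds -/

theorem corollary3p2
    {E : Type*} [NormedAddCommGroup E] [NormedSpace ℝ E] [FiniteDimensional ℝ E]
    {M : Type*} [TopologicalSpace M] [ChartedSpace E M] [IsManifold 𝓘(ℝ, E) ∞ M]
    {E' : Type*} [NormedAddCommGroup E'] [NormedSpace ℝ E'] [FiniteDimensional ℝ E']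
    {M' : Type*} [TopologicalSpace M'] [ChartedSpace E' M'] [IsManifold 𝓘(ℝ, E') ∞ M']
    (m n : ℕ) (J : Fin 3 → EndField E' M') (g : BilinField E' M') (ι : M → M')
    (hW : IsWManifold n J g)
    (hι : IsHolomorphicSubmanifold (E := E) m n ι J g)
    (hgeo : IsTotallyGeodesic E ι g) :
    IsWManifold (E := E) m (fun α ↦ inducedEnd ι (J α)) (inducedMetric ι g) ∧
      ∀ (α : Fin 3) (p : M), (∃ z, leeForm g (J α) (ι p) z ≠ 0) →
        ∃ z, leeForm (E := E) (inducedMetric ι g) (inducedEnd ι (J α)) p z ≠ 0 := by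
  have hHN := hι.isAlmostHypercomplexHN hW.toIsAlmostHypercomplexHN
  have hJ (α : Fin 3) (q : M') :
      MDifferentiableAt 𝓘(ℝ, E') 𝓘(ℝ, E' →L[ℝ] E') (endInChart (J α) q) q :=
    ((contMDiffAt_endField_iff (J α) q).1 (hW.smooth α q)).mdifferentiableAt (by simp)
  have hJi (α : Fin 3) (p : M) : MDifferentiableAt 𝓘(ℝ, E) 𝓘(ℝ, E →L[ℝ] E)
      (endInChart (E := E) (inducedEnd ι (J α)) p) p :=
    ((contMDiffAt_endField_iff _ p).1 (hHN.smooth α p)).mdifferentiableAt (by simp)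
  have hgi (p : M) : MDifferentiableAt 𝓘(ℝ, E) 𝓘(ℝ, E →L[ℝ] E →L[ℝ] ℝ)
      (metricInChart (E := E) (inducedMetric ι g) p) p :=
    ((contMDiffAt_bilinField_iff _ p).1 (hHN.metric.smooth p)).mdifferentiableAt (by simp)
  let θ (α : Fin 3) (p : M) : TangentSpace 𝓘(ℝ, E) p →ₗ[ℝ] ℝ :=
    leeLinear g (J α) (ι p) ∘ₗ (mfderiv 𝓘(ℝ, E) 𝓘(ℝ, E') ι p).toLinearMap
  have hconf (α : Fin 3) (p : M) : IsConformalType (hnSign α) (hnConst n α)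
      (inducedMetric ι g) (inducedEnd ι (J α)) (θ α) p := by
    intro x y z
    rw [fundamentalTensor_inducedMetric hι hgeo (hJ α _) (hJi α p), hW.isConformalType]
    simp only [inducedMetric_apply, θ, LinearMap.comp_apply, ContinuousLinearMap.coe_coe,
      mfderiv_inducedEnd hι]
  -- Each structure is the product of the other two, which anticommute; its zero trace removes the
  -- `J` term from the contraction.
  have htr (α : Fin 3) (p : M) :
      LinearMap.trace ℝ _ (inducedEnd (E := E) ι (J α) p).toLinearMap = 0 := by
    have : FiniteDimensional ℝ (TangentSpace 𝓘(ℝ, E) p) := ‹FiniteDimensional ℝ E›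
    exact trace_eq_zero_of_anticommute (A := (inducedEnd (E := E) ι (J (α + 1)) p).toLinearMap)
      (B := (inducedEnd (E := E) ι (J (α + 2)) p).toLinearMap) (hHN.comp α p)
      (hHN.comp_rev α p)
  have hn : 0 < n := hι.pos.trans hι.lt
  have hm' := fun α ↦ four_mul_add_hnSign_sub_one_pos hι.pos α
  have hn' := fun α ↦ four_mul_add_hnSign_sub_one_pos hn α
  have hlee (α : Fin 3) (p : M) (z : TangentSpace 𝓘(ℝ, E) p) :
      leeForm (inducedMetric ι g) (inducedEnd ι (J α)) p z =
        hnConst n α * (4 * m + hnSign α - 1) * θ α p z := by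
    rw [leeForm_eq_of_isConformalType (hHN.metric.symm p) (hHN.metric.nondegenerate p)
      (hHN.sq α p) (htr α p) (hconf α p), hι.dim]
    push_cast
    rfl
  have hF (α : Fin 3) (p : M) : IsConformalType (hnSign α) (hnConst m α)
      (inducedMetric ι g) (inducedEnd ι (J α)) (leeLinear (E := E) (inducedMetric ι g) (inducedEnd ι (J α))) p := by
    intro x y z
    have hlee' : ∀ z, leeLinear (inducedMetric ι g) (inducedEnd ι (J α)) p z =
        hnConst n α * (4 * m + hnSign α - 1) * θ α p z := hlee α p
    -- The factor `4m + δ - 1` is the inverse of `hnConst m α`: passing from the pullback to the Lee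
    -- form of `M` trades the constant of dimension `4n` for that of `4m`.
    have hconst : hnConst n α = hnConst m α * (hnConst n α * (4 * m + hnSign α - 1)) := by
      rw [hnConst, hnConst]
      field_simp [(hm' α).ne']
    rw [hconf α p x y z, hlee', hlee', hlee', hlee']
    linear_combination (inducedMetric ι g p x y * θ α p z
      + hnSign α * (inducedMetric ι g p x z * θ α p y)
      + hnSign α * (inducedMetric ι g p x (inducedEnd ι (J α) p y) *
        θ α p (inducedEnd ι (J α) p z))
      + inducedMetric ι g p x (inducedEnd ι (J α) p z) *
        θ α p (inducedEnd ι (J α) p y)) * hconst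
  refine ⟨⟨hHN, ?_, ?_, ?_⟩, ?_⟩
  · intro α X Y p hX hY
    exact nijenhuis_eq_zero_of_isConformalType hHN.metric.symm (hHN.metric.nondegenerate p)
      (hHN.sq α) (hnSign_eq α) (hHN.adjoint α p) (hconf α p) (hgi p) (hJi α p) hX hY
  · intro p x y z
    rw [hF 0 p x y z, hnConst_zero, hnSign, if_pos rfl]
    simp only [leeLinear_apply]
    ring
  · intro α hα p x y z
    rw [hF α p x y z, hnConst_of_ne m hα, hnSign, if_neg hα]
    simp only [leeLinear_apply]
    ring
  · rintro α p ⟨w, hw⟩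
    by_contra! hzero
    have : FiniteDimensional ℝ (TangentSpace 𝓘(ℝ, E) p) := ‹FiniteDimensional ℝ E›
    have hc : hnConst n α ≠ 0 := (one_div_pos.2 (hn' α)).ne'
    have hθ (z : TangentSpace 𝓘(ℝ, E) p) : θ α p z = 0 := by
      have h1 := hzero z
      rw [hlee] at h1
      exact (mul_eq_zero.1 h1).resolve_left (mul_ne_zero hc (hm' α).ne')
    -- Split `w` into a tangent part `dι x`, on which the ambient Lee form vanishes by `hθ`, and a
    -- normal part, on which it vanishes by `eq_zero_of_normal`.
    obtain ⟨x, hx⟩ := exists_add_orthogonal (bilinFormAt g (ι p))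
      (mfderiv 𝓘(ℝ, E) 𝓘(ℝ, E') ι p).toLinearMap (hι.nondegenerate p) w
    have hδ : hnSign α ≠ 0 := by rcases hnSign_eq α with h | h <;> rw [h] <;> norm_num
    have hξ := eq_zero_of_normal hι hgeo (hJ α _) (hJi α p) hW.metric.symm (hW.sq α _) hc hδ
      (hW.adjoint α _) (hW.isConformalType α _) hx
    rw [map_sub, sub_eq_zero] at hξ
    exact hw (hξ.trans (hθ x))
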